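/- Let $f(x)=\arctan(1/x)-\frac{x}{1+x^2}$ for real $x\neq 0$, $f(0)=0$. A function $K:\mathbb{C}\to\mathbb{C}$ is called real entire if it is entire and real-valued on $\mathbb{R}$; it has exponential type at most $2\pi\Delta$ if for every $\varepsilon>0$ there is $C_\varepsilon>0$ with $|K(z)|\le C_\varepsilon e^{(2\pi\Delta+\varepsilon)|z|}$ for all $z\in\mathbb{C}$. A real entire $K$ of exponential type at most $2\pi\Delta$ with $K\ge f$ (respectively $K\le f$) on $\mathbb{R}$ is an extremal majorant (respectively extremal minorant) of $f$ of type $2\pi\Delta$ if it minimizes $\int_{-\infty}^{\infty}|f(x)-K(x)|\,dx$ among all such functions. There is an absolute constant $C>0$ such that for every real $\Delta\ge 1$ there are real entire functions $m_\Delta^-$ and $m_\Delta^+$ with the following properties. (i) For all real $x$, $$\frac{-C}{1+x^2}\le m_\Delta^-(x)\le f(x)\le m_\Delta^+(x)\le\frac{C}{1+x^2},$$ and for all complex $z=x+iy$, $$|m_\Delta^\pm(z)|\le C\,\frac{\Delta^2}{1+\Delta|z|}\,e^{2\pi\Delta|y|}.$$ (ii) The functions $m_\Delta^\pm$ are integrable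 on $\mathbb{R}$, and their Fourier transforms $\widehat m_\Delta^\pm(\xi)=\int_{-\infty}^\infty m_\Delta^\pm(x)e^{-2\pi i x\xi}\,dx$ are continuous, vanish outside $[-\Delta,\Delta]$, and satisfy $|\widehat m_\Delta^\pm(\xi)|\le C$ for all $\xi\in[-\Delta,\Delta]$. (iii) The functions $m_\Delta^+-f$ and $f-m_\Delta^-$ are integrable on $\mathbb{R}$, and $$\int_{-\infty}^{\infty}\{m_\Delta^+(x)-f(x)\}\,dx=\int_{-\infty}^{\infty}\{f(x)-m_\Delta^-(x)\}\,dx=\frac{\pi}{2\Delta}.$$ Moreover, $m_\Delta^-$ is an extremal minorant and $m_\Delta^+$ an extremal majorant of $f$ of type $2\pi\Delta$. They are unique: for each $\Delta\ge1$, any pair of real entire functions satisfying (i)–(iii), with any constant in place of $C$, equals $(m_\Delta^-,m_\Delta^+)$, and $m_\Delta^-$ and $m_\Delta^+$ are the only extremal minorant and the only extremal majorant of $f$ of type $2\pi\Delta$. -/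

import Mathlib

open scoped FourierTransform

noncomputable section

/-- The odd function `f(x) = arctan(1/x) - x/(1+x²)`. At the jump `x = 0` its value here is `0`,
the value given by oddness; majorants and minorants are continuous and
`f(0±) = ±π/2`, so the value at that single point has no influence on anything below. -/
def oddF (x : ℝ) : ℝ := Real.arctan (1 / x) - x / (1 + x ^ 2)

/-- A real entire function: entire, and real-valued on the real line. -/
structure IsRealEntire (K : ℂ → ℂ) : Prop where
  entire : Differentiable ℂ K
  real : ∀ x : ℝ, (K x).im = 0

/-- `K` has exponential type at most `τ`. -/
def HasExpTypeAtMost (τ : ℝ) (K : ℂ → ℂ) : Prop :=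
  ∀ ε : ℝ, 0 < ε → ∃ C : ℝ, 0 < C ∧ ∀ z : ℂ, ‖K z‖ ≤ C * Real.exp ((τ + ε) * ‖z‖)

/-- `K` is a real entire majorant of `F` on the real line, of exponential type at most `2πΔ`. -/
structure IsMajorant (Δ : ℝ) (F : ℝ → ℝ) (K : ℂ → ℂ) : Prop where
  realEntire : IsRealEntire K
  expType : HasExpTypeAtMost (2 * Real.pi * Δ) K
  le : ∀ x : ℝ, F x ≤ (K x).re

/-- `K` is a real entire minorant of `F` on the real line, of exponential type at most `2πΔ`. -/
structure IsMinorant (Δ : ℝ) (F : ℝ → ℝ) (K : ℂ → ℂ) : Prop where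
  realEntire : IsRealEntire K
  expType : HasExpTypeAtMost (2 * Real.pi * Δ) K
  le : ∀ x : ℝ, (K x).re ≤ F x

/-- The `L¹(ℝ)`-distance `∫ |F(x) - K(x)| dx`, possibly infinite. -/
def l1Dist (F : ℝ → ℝ) (K : ℂ → ℂ) : ENNReal :=
  ∫⁻ x : ℝ, ‖(F x : ℂ) - K x‖ₑ

/-- An extremal majorant of type `2πΔ`: one that minimizes the `L¹`-distance to `F`. -/
def IsExtremalMajorant (Δ : ℝ) (F : ℝ → ℝ) (K : ℂ → ℂ) : Prop :=
  IsMajorant Δ F K ∧ ∀ L : ℂ → ℂ, IsMajorant Δ F L → l1Dist F K ≤ l1Dist F L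

/-- An extremal minorant of type `2πΔ`: one that minimizes the `L¹`-distance to `F`. -/
def IsExtremalMinorant (Δ : ℝ) (F : ℝ → ℝ) (K : ℂ → ℂ) : Prop :=
  IsMinorant Δ F K ∧ ∀ L : ℂ → ℂ, IsMinorant Δ F L → l1Dist F K ≤ l1Dist F L

/-- `|K(x+iy)| ≤ C Δ² e^{2πΔ|y|} / (1 + Δ|z|)` for all `z = x + iy`. -/
def HasGrowthBound (C Δ : ℝ) (K : ℂ → ℂ) : Prop :=
  ∀ z : ℂ, ‖K z‖ ≤ C * (Δ ^ 2 / (1 + Δ * ‖z‖) * Real.exp (2 * Real.pi * Δ * |z.im|))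

/-- The Fourier transform `ξ ↦ ∫ K(x) e^{-2πixξ} dx` of the restriction of `K` to `ℝ` is
continuous, vanishes outside `[-Δ, Δ]`, and is bounded by `C`. The function itself is integrable. -/
structure HasBandlimitedFourier (C Δ : ℝ) (K : ℂ → ℂ) : Prop where
  integrable : MeasureTheory.Integrable (fun x : ℝ => K x)
  continuous : Continuous (𝓕 (fun x : ℝ => K x))
  support : ∀ ξ : ℝ, ξ ∉ Set.Icc (-Δ) Δ → 𝓕 (fun x : ℝ => K x) ξ = 0
  bound : ∀ ξ ∈ Set.Icc (-Δ) Δ, ‖𝓕 (fun x : ℝ => K x) ξ‖ ≤ C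

/-- The pair `(m⁻, m⁺)` of real entire functions majorizes and minorizes `oddF` with the decay on `ℝ`, growth on `ℂ`,
band-limited Fourier transforms and `L¹`-distances `π/(2Δ)`, with
the constant `C` in every bound. -/
structure ExtremalProperties (C Δ : ℝ) (mm mp : ℂ → ℂ) : Prop where
  realEntire_m : IsRealEntire mm
  realEntire_p : IsRealEntire mp
  ineq : ∀ x : ℝ, -C / (1 + x ^ 2) ≤ (mm x).re ∧ (mm x).re ≤ oddF x ∧
    oddF x ≤ (mp x).re ∧ (mp x).re ≤ C / (1 + x ^ 2)
  growth_m : HasGrowthBound C Δ mm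
  growth_p : HasGrowthBound C Δ mp
  fourier_m : HasBandlimitedFourier C Δ mm
  fourier_p : HasBandlimitedFourier C Δ mp
  integrable_p : MeasureTheory.Integrable (fun x : ℝ => (mp x).re - oddF x)
  integral_p : ∫ x : ℝ, ((mp x).re - oddF x) = Real.pi / (2 * Δ)
  integrable_m : MeasureTheory.Integrable (fun x : ℝ => oddF x - (mm x).re)
  integral_m : ∫ x : ℝ, (oddF x - (mm x).re) = Real.pi / (2 * Δ)

end

open MeasureTheory Filter Topology Set

/-! Lower bound: an integrable function `K` of type `2πΔ` has a Fourier transform supported in `[-Δ,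
Δ]` and zero at both end points. Poisson summation therefore gives the exact quadrature `Δ ∫ K = ∑ K
(n / Δ)`. If `K` majorizes the odd function `oddF`, then `K (n / Δ) + K (-n / Δ) ≥ 0` for `n ≠ 0`,
and `K 0 ≥ π / 2` by the one-sided limit at the jump. Hence `∫ K ≥ π / (2Δ)`. As `∫ oddF = 0`, this
is a lower bound for the `L¹`-distance (`IsMajorant.le_integral`).

Uniqueness: equality forces `K` to take the value `π / 2` at `0` and to touch `oddF` at every other
`n / Δ`, so values and derivatives are prescribed there. The difference of two such functions is
integrable, vanishes at all nodes, and doubly so away from `0`; comparing the periodized transforms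
of it and of its derivative shows that it is zero (`HasExpTypeAtMost.eq_zero_of_zeros`,
`IsMajorant.unique`).

Existence: `oddF x = ∫₀¹ x / (x² + s²) ds - x / (x² + 1)`, and `x / (x² + s²)` is half of `1 / (x -
is) + 1 / (x + is)`. With `P z = (sin (πΔz) / z)²`, each `1 / (z - is)` is replaced by the entire
function `(1 - P z / P (is)) / (z - is)`, which agrees with it at the nodes `n / Δ`, `n ≠ 0`. On the
real line this costs `P x * gapIntegral Δ x`, and `|gapIntegral Δ x| ≤ 1 / (2πΔ²)`. Adding `P /
(2πΔ²)` thus yields a majorant, and the same term makes its value at `0` exactly `π / 2`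
(`extremalMajorant_ofReal`, `abs_gapIntegral_le`).

Minorants are the reflections `z ↦ -K (-z)` of majorants. The complex growth bounds follow from the
bounds on the real line by Phragmén–Lindelöf. -/

/-! ### Exponential type and the Phragmén–Lindelöf bound -/

theorem HasExpTypeAtMost.comp_neg {τ : ℝ} {F : ℂ → ℂ} (h : HasExpTypeAtMost τ F) :
    HasExpTypeAtMost τ (fun z => F (-z)) := fun ε hε => by
  obtain ⟨C, hC, hb⟩ := h ε hε
  exact ⟨C, hC, fun z => by simpa using hb (-z)⟩

theorem HasExpTypeAtMost.neg {τ : ℝ} {F : ℂ → ℂ} (h : HasExpTypeAtMost τ F) :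
    HasExpTypeAtMost τ (fun z => -F z) := fun ε hε => by
  obtain ⟨C, hC, hb⟩ := h ε hε
  exact ⟨C, hC, fun z => by simpa using hb z⟩

theorem HasExpTypeAtMost.sub {τ : ℝ} {F G : ℂ → ℂ} (hF : HasExpTypeAtMost τ F)
    (hG : HasExpTypeAtMost τ G) : HasExpTypeAtMost τ (fun z => F z - G z) := fun ε hε => by
  obtain ⟨C, hC, hb⟩ := hF ε hε
  obtain ⟨C', hC', hb'⟩ := hG ε hε
  refine ⟨C + C', by positivity, fun z => (norm_sub_le _ _).trans ?_⟩
  rw [add_mul]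
  exact add_le_add (hb z) (hb' z)

theorem HasExpTypeAtMost.mul {τ σ : ℝ} {F G : ℂ → ℂ} (hF : HasExpTypeAtMost τ F)
    (hG : HasExpTypeAtMost σ G) : HasExpTypeAtMost (τ + σ) (fun z => F z * G z) := fun ε hε => by
  obtain ⟨C, hC, hb⟩ := hF (ε / 2) (by positivity)
  obtain ⟨C', hC', hb'⟩ := hG (ε / 2) (by positivity)
  refine ⟨C * C', by positivity, fun z => ?_⟩
  rw [norm_mul, show (τ + σ + ε) * ‖z‖ = (τ + ε / 2) * ‖z‖ + (σ + ε / 2) * ‖z‖ by ring, Real.exp_add]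
  calc _ ≤ _ := mul_le_mul (hb z) (hb' z) (norm_nonneg _) (by positivity)
    _ = _ := by ring

theorem HasExpTypeAtMost.of_bound {τ A : ℝ} {F : ℂ → ℂ}
    (h : ∀ z, ‖F z‖ ≤ A * Real.exp (τ * ‖z‖)) : HasExpTypeAtMost τ F := fun ε hε => by
  refine ⟨|A| + 1, by positivity, fun z => (h z).trans ?_⟩
  gcongr
  · linarith [le_abs_self A]
  · linarith

theorem hasExpTypeAtMost_id : HasExpTypeAtMost 0 (fun z => z) := fun ε hε => by
  refine ⟨1 / ε, by positivity, fun z => ?_⟩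
  have := Real.add_one_le_exp ((0 + ε) * ‖z‖)
  rw [div_mul_eq_mul_div, one_mul, le_div_iff₀ hε]
  linarith

theorem hasExpTypeAtMost_cexp (a : ℂ) : HasExpTypeAtMost ‖a‖ (fun z => Complex.exp (a * z)) :=
  .of_bound (A := 1) fun z => by
    rw [one_mul, ← norm_mul]
    exact Complex.norm_exp_le_exp_norm _

theorem HasExpTypeAtMost.comp_mul_left {τ a : ℝ} {F : ℂ → ℂ} (ha : 0 < a)
    (h : HasExpTypeAtMost τ F) : HasExpTypeAtMost (τ * a) (fun z => F (a * z)) := fun ε hε => by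
  obtain ⟨C, hC, hb⟩ := h (ε / a) (by positivity)
  refine ⟨C, hC, fun z => (hb _).trans (le_of_eq ?_)⟩
  rw [norm_mul, Complex.norm_real, Real.norm_of_nonneg ha.le]
  congr 2
  field_simp

theorem HasExpTypeAtMost.comp_add {τ : ℝ} (hτ : 0 ≤ τ) {F : ℂ → ℂ}
    (h : HasExpTypeAtMost τ F) (w : ℂ) : HasExpTypeAtMost τ (fun z => F (z + w)) := fun ε hε => by
  obtain ⟨C, hC, hb⟩ := h ε hε
  refine ⟨C * Real.exp ((τ + ε) * ‖w‖), by positivity, fun z => (hb _).trans ?_⟩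
  rw [mul_assoc, ← Real.exp_add]
  gcongr
  have := mul_le_mul_of_nonneg_left (norm_add_le z w) (by positivity : 0 ≤ τ + ε)
  linarith

/-- Cauchy's estimate on the unit circle around `z` costs only the factor `exp (τ + ε)`. -/
theorem HasExpTypeAtMost.of_deriv {τ : ℝ} (hτ : 0 ≤ τ) {F : ℂ → ℂ} (hF : Differentiable ℂ F)
    (h : HasExpTypeAtMost τ F) : HasExpTypeAtMost τ (deriv F) := fun ε hε => by
  obtain ⟨C, hC, hb⟩ := h ε hε
  refine ⟨C * Real.exp (τ + ε), by positivity, fun z => ?_⟩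
  have := Complex.norm_deriv_le_of_forall_mem_sphere_norm_le (c := z) one_pos hF.diffContOnCl
    (C := C * Real.exp (τ + ε) * Real.exp ((τ + ε) * ‖z‖)) fun w hw => (hb w).trans ?_
  · simpa using this
  · rw [mul_assoc, ← Real.exp_add]
    gcongr
    have h1 : ‖w‖ ≤ ‖z‖ + 1 := by
      have := norm_add_le z (w - z)
      rw [mem_sphere_iff_norm] at hw
      simpa [hw] using this
    have := mul_le_mul_of_nonneg_left h1 (by positivity : 0 ≤ τ + ε)
    linarith

theorem HasExpTypeAtMost.norm_le_of_bounded_of_im_nonneg {τ M : ℝ} {F : ℂ → ℂ}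
    (hF : Differentiable ℂ F) (h : HasExpTypeAtMost τ F) (hM : ∀ x : ℝ, ‖F x‖ ≤ M) {z : ℂ}
    (hz : 0 ≤ z.im) : ‖F z‖ ≤ M * Real.exp (τ * z.im) := by
  have key : ∀ ε : ℝ, 0 < ε → ‖F z‖ ≤ M * Real.exp ((τ + ε) * z.im) := fun ε hε => by
    obtain ⟨C, hC, hb⟩ := h ε hε
    -- Rotating by `I` turns the upper half plane into the right one. The exponential factor makes
    -- `g` bounded on the positive axis, while on the imaginary axis `|g| = |F| ≤ M`;
    -- Phragmén–Lindelöf then gives `|g| ≤ M` throughout, and `ε → 0` at the end.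
    set g : ℂ → ℂ := fun w => F (Complex.I * w) * Complex.exp (-((τ + ε : ℝ) : ℂ) * w) with hg
    have hgn : ∀ w, ‖g w‖ = ‖F (Complex.I * w)‖ * Real.exp (-((τ + ε) * w.re)) := fun w => by
      rw [hg]
      simp only [norm_mul, Complex.norm_exp]
      congr 2
      simp
      ring
    have hd : Differentiable ℂ g := by
      simp only [hg]
      exact (hF.comp (differentiable_id.const_mul _)).mul (by fun_prop)
    have hre : ∀ x : ℝ, 0 ≤ x → ‖g x‖ ≤ C := fun x hx => by
      rw [hgn]
      have := hb (Complex.I * x)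
      rw [norm_mul, Complex.norm_I, one_mul, Complex.norm_real, Real.norm_of_nonneg hx] at this
      calc _ ≤ C * Real.exp ((τ + ε) * x) * Real.exp (-((τ + ε) * x)) := by
            simp only [Complex.ofReal_re]
            gcongr
        _ = C := by rw [mul_assoc, ← Real.exp_add]; simp
    have := PhragmenLindelof.right_half_plane_of_bounded_on_real (f := g) (C := M)
      (z := -Complex.I * z) hd.diffContOnCl ?_ ?_ ?_ (by simpa using hz)
    · rw [hgn, ← mul_assoc] at this
      simp only [mul_neg, Complex.I_mul_I, neg_neg, one_mul] at this
      rw [Real.exp_neg, ← div_eq_mul_inv, div_le_iff₀ (Real.exp_pos _)] at this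
      simpa using this
    · refine ⟨1, by norm_num, (|τ + ε| + |τ + ε|), ?_⟩
      refine Asymptotics.IsBigO.of_bound C (Eventually.of_forall fun w => ?_)
      rw [hgn, Real.norm_of_nonneg (Real.exp_pos _).le, Real.rpow_one,
        add_mul |τ + ε| |τ + ε|, Real.exp_add, ← mul_assoc]
      refine mul_le_mul ((hb _).trans ?_) ?_ (Real.exp_pos _).le (by positivity)
      · rw [norm_mul, Complex.norm_I, one_mul]
        gcongr
        exact le_abs_self _
      · refine Real.exp_le_exp.2 ((neg_le_abs _).trans ?_)
        rw [abs_mul]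
        gcongr
        exact Complex.abs_re_le_norm w
    · refine ⟨C, ?_⟩
      rw [eventually_map]
      filter_upwards [eventually_ge_atTop (0 : ℝ)] with x hx using hre x hx
    · intro x
      rw [hgn, show Complex.I * (x * Complex.I) = ((-x : ℝ) : ℂ) by
        push_cast; linear_combination (x : ℂ) * Complex.I_mul_I]
      simpa using hM (-x)
  have hlim : Tendsto (fun ε : ℝ => M * Real.exp ((τ + ε) * z.im)) (𝓝[>] 0)
      (𝓝 (M * Real.exp ((τ + 0) * z.im))) :=
    Tendsto.mono_left (Continuous.tendsto (by fun_prop) 0) nhdsWithin_le_nhds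
  rw [add_zero] at hlim
  exact ge_of_tendsto hlim (by filter_upwards [self_mem_nhdsWithin] with ε hε using key ε hε)

/-- An entire function of exponential type `τ` bounded on the real line grows at most like
`exp (τ |Im z|)`. -/
theorem HasExpTypeAtMost.norm_le_of_bounded {τ M : ℝ} {F : ℂ → ℂ}
    (hF : Differentiable ℂ F) (h : HasExpTypeAtMost τ F) (hM : ∀ x : ℝ, ‖F x‖ ≤ M) (z : ℂ) :
    ‖F z‖ ≤ M * Real.exp (τ * |z.im|) := by
  rcases le_total 0 z.im with hz | hz
  · rw [abs_of_nonneg hz]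
    exact h.norm_le_of_bounded_of_im_nonneg hF hM hz
  · rw [abs_of_nonpos hz]
    have := h.comp_neg.norm_le_of_bounded_of_im_nonneg (hF.comp differentiable_neg) (M := M)
      (fun x => by simpa using hM (-x)) (z := -z) (by simpa using hz)
    simpa using this

/-! ### Window integrals and `L¹` bounds by duality -/

theorem hasDerivAt_intervalIntegral_of_continuous {F F' : ℂ → ℝ → ℂ} {a b : ℝ}
    (hF : Continuous (Function.uncurry F)) (hF' : Continuous (Function.uncurry F'))
    (h : ∀ z t, HasDerivAt (fun w => F w t) (F' z t) z) (z : ℂ) :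
    HasDerivAt (fun w => ∫ t in a..b, F w t) (∫ t in a..b, F' z t) z := by
  have hc : IsCompact (Metric.closedBall z 1 ×ˢ uIcc a b) :=
    (isCompact_closedBall z 1).prod isCompact_uIcc
  obtain ⟨B, hB⟩ := hc.exists_bound_of_continuousOn hF'.continuousOn
  refine (intervalIntegral.hasDerivAt_integral_of_dominated_loc_of_deriv_le (bound := fun _ => B)
    (Metric.ball_mem_nhds z one_pos) (Eventually.of_forall fun w => ?_) ?_ ?_ ?_ ?_ ?_).2
  · exact (hF.comp (Continuous.prodMk_right w)).aestronglyMeasurable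
  · exact (hF.comp (Continuous.prodMk_right z)).intervalIntegrable _ _
  · exact (hF'.comp (Continuous.prodMk_right z)).aestronglyMeasurable
  · refine Eventually.of_forall fun t ht w hw => hB (w, t) ⟨Metric.ball_subset_closedBall hw, ?_⟩
    exact uIoc_subset_uIcc ht
  · exact intervalIntegrable_const
  · exact Eventually.of_forall fun t _ w _ => h w t

theorem continuous_deriv_of_entire {F : ℂ → ℂ} (hF : Differentiable ℂ F) :
    Continuous (deriv F) := (hF.contDiff (n := 1)).continuous_deriv le_rfl

section window

variable {F : ℂ → ℂ} {φ : ℝ → ℂ}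

theorem hasDerivAt_integral_window (hF : Differentiable ℂ F) (hφ : Continuous φ) (R : ℝ) (z : ℂ) :
    HasDerivAt (fun w => ∫ t in -R..R, F (w + t) * φ t) (∫ t in -R..R, deriv F (z + t) * φ t) z := by
  have hc := hF.continuous
  have hc' := continuous_deriv_of_entire hF
  refine hasDerivAt_intervalIntegral_of_continuous (F := fun w t => F (w + t) * φ t)
    (F' := fun w t => deriv F (w + t) * φ t) ?_ ?_ (fun w t => ?_) z
  · simp only [Function.uncurry_def]; fun_prop
  · simp only [Function.uncurry_def]; fun_prop
  · exact ((hF (w + t)).hasDerivAt.comp_add_const w (t : ℂ)).mul_const _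

/-- As a function of `z` the window integral is entire of type `τ` and is bounded on the real line
by the `L¹` norm of `F`, so Phragmén–Lindelöf applies. The bound is uniform in `R` and `φ`, which is
what lets duality recover the `L¹` norm on a horizontal line. -/
theorem norm_integral_window_le {τ : ℝ} (hτ : 0 ≤ τ) (hF : Differentiable ℂ F)
    (hE : HasExpTypeAtMost τ F) (hi : Integrable (fun x : ℝ => F x)) (hφ : Continuous φ)
    (hφ1 : ∀ t, ‖φ t‖ ≤ 1) {R : ℝ} (hR : 0 ≤ R) (z : ℂ) :
    ‖∫ t in -R..R, F (z + t) * φ t‖ ≤ (∫ x : ℝ, ‖F x‖) * Real.exp (τ * |z.im|) := by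
  have hc := hF.continuous
  refine HasExpTypeAtMost.norm_le_of_bounded (F := fun w => ∫ t in -R..R, F (w + t) * φ t)
    (fun w => (hasDerivAt_integral_window hF hφ R w).differentiableAt) (fun ε hε => ?_)
    (fun x => ?_) z
  · obtain ⟨C, hC, hb⟩ := hE ε hε
    refine ⟨C * Real.exp ((τ + ε) * R) * (2 * R + 1), by positivity, fun w => ?_⟩
    have := intervalIntegral.norm_integral_le_of_norm_le_const (a := -R) (b := R)
      (f := fun t : ℝ => F (w + t) * φ t)
      (C := C * Real.exp ((τ + ε) * R) * Real.exp ((τ + ε) * ‖w‖)) fun t ht => ?_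
    · refine this.trans ?_
      rw [abs_of_nonneg (by linarith)]
      have h0 : 0 ≤ C * Real.exp ((τ + ε) * R) * Real.exp ((τ + ε) * ‖w‖) := by positivity
      nlinarith
    · rw [norm_mul]
      have h1 : ‖w + t‖ ≤ ‖w‖ + R := by
        refine (norm_add_le _ _).trans ?_
        rw [Complex.norm_real, Real.norm_eq_abs]
        rw [uIoc_of_le (by linarith)] at ht
        have := abs_le.2 ⟨ht.1.le, ht.2⟩
        linarith
      have h2 := mul_le_mul_of_nonneg_left h1 (by positivity : 0 ≤ τ + ε)
      calc ‖F (w + t)‖ * ‖φ t‖ ≤ C * Real.exp ((τ + ε) * ‖w + t‖) * 1 :=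
            mul_le_mul (hb _) (hφ1 t) (norm_nonneg _) (by positivity)
        _ ≤ C * Real.exp ((τ + ε) * R + (τ + ε) * ‖w‖) := by
            rw [mul_one]; gcongr; linarith
        _ = _ := by rw [Real.exp_add]; ring
  · have hn : Integrable (fun t : ℝ => ‖F (x + t)‖) := by
      have := (hi.norm.comp_add_left x)
      simpa using this
    calc _ ≤ ∫ t in -R..R, ‖F (x + t) * φ t‖ :=
          intervalIntegral.norm_integral_le_integral_norm (by linarith)
      _ ≤ ∫ t in -R..R, ‖F (x + t)‖ := by
          refine intervalIntegral.integral_mono_on (by linarith) ?_ hn.intervalIntegrable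
            fun t _ => ?_
          · exact Continuous.intervalIntegrable (by fun_prop) _ _
          · rw [norm_mul]
            exact mul_le_of_le_one_right (norm_nonneg _) (hφ1 t)
      _ ≤ ∫ t : ℝ, ‖F (x + t)‖ := by
          rw [intervalIntegral.integral_of_le (by linarith)]
          exact setIntegral_le_integral hn (Eventually.of_forall fun _ => norm_nonneg _)
      _ = ∫ t : ℝ, ‖F t‖ := by
          have := integral_add_left_eq_self (μ := volume) (fun t : ℝ => ‖F t‖) x
          simpa using this

end window

/-- If all the pairings of a continuous `g` with continuous `φ`, `‖φ‖ ≤ 1`, over bounded symmetric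
intervals are at most `N`, then `g` is integrable with `L¹` norm at most `N`. -/
theorem integrable_of_pairing_le {g : ℝ → ℂ} (hg : Continuous g) {N : ℝ}
    (h : ∀ φ : ℝ → ℂ, Continuous φ → (∀ t, ‖φ t‖ ≤ 1) → ∀ R : ℝ, 0 ≤ R →
      ‖∫ t in -R..R, g t * φ t‖ ≤ N) :
    Integrable g ∧ ∫ t, ‖g t‖ ≤ N := by
  have key : ∀ R : ℝ, 0 ≤ R → ∫ t in -R..R, ‖g t‖ ≤ N := fun R hR => by
    have h1 : ∀ ε : ℝ, 0 < ε → ∫ t in -R..R, ‖g t‖ ≤ N + ε * (2 * R) := fun ε hε => by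
      have hne : ∀ t, ((‖g t‖ + ε : ℝ) : ℂ) ≠ 0 := fun t => by
        rw [Complex.ofReal_ne_zero]; positivity
      -- The extremal multiplier `conj g / |g|` may be discontinuous at zeros of `g`. Adding `ε` to
      -- the denominator repairs this and loses at most `ε` pointwise, since `|g|² / (|g| + ε) ≥ |g|
      -- - ε`.
      set φ : ℝ → ℂ := fun t => (starRingEnd ℂ) (g t) / ((‖g t‖ + ε : ℝ) : ℂ) with hφ
      have hφc : Continuous φ := by
        refine (Complex.continuous_conj.comp hg).div ?_ hne
        fun_prop
      have hφ1 : ∀ t, ‖φ t‖ ≤ 1 := fun t => by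
        rw [hφ, norm_div, RCLike.norm_conj, Complex.norm_real, Real.norm_of_nonneg (by positivity)]
        exact div_le_one_of_le₀ (by linarith) (by positivity)
      have h2 := h φ hφc hφ1 R hR
      have h3 : ∀ t, g t * φ t = ((‖g t‖ ^ 2 / (‖g t‖ + ε) : ℝ) : ℂ) := fun t => by
        simp only [hφ]
        rw [mul_div_assoc', Complex.mul_conj, Complex.normSq_eq_norm_sq]
        push_cast
        rfl
      simp_rw [h3] at h2
      rw [intervalIntegral.integral_ofReal, Complex.norm_real] at h2
      have h4 : ∫ t in -R..R, (‖g t‖ - ε) ≤ ∫ t in -R..R, ‖g t‖ ^ 2 / (‖g t‖ + ε) := by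
        refine intervalIntegral.integral_mono_on (by linarith) ?_ ?_ fun t _ => ?_
        · exact Continuous.intervalIntegrable (by fun_prop) _ _
        · refine Continuous.intervalIntegrable (Continuous.div (by fun_prop) (by fun_prop)
            fun t => ?_) _ _
          positivity
        · rw [le_div_iff₀ (by positivity)]
          nlinarith
      rw [intervalIntegral.integral_sub (hg.norm.intervalIntegrable _ _)
        intervalIntegrable_const, intervalIntegral.integral_const, smul_eq_mul] at h4
      have := (le_abs_self _).trans h2
      linarith
    have hlim : Tendsto (fun ε : ℝ => N + ε * (2 * R)) (𝓝[>] 0) (𝓝 (N + 0 * (2 * R))) :=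
      Tendsto.mono_left (Continuous.tendsto (by fun_prop) 0) nhdsWithin_le_nhds
    rw [zero_mul, add_zero] at hlim
    exact ge_of_tendsto hlim (by filter_upwards [self_mem_nhdsWithin] with ε hε using h1 ε hε)
  have hloc : ∀ n : ℕ, IntegrableOn g (Ioc (-(n : ℝ)) n) := fun n =>
    (hg.integrableOn_Icc).mono_set Ioc_subset_Icc_self
  have hint : Integrable g :=
    integrable_of_intervalIntegral_norm_bounded (a := fun n : ℕ => -(n : ℝ)) (b := fun n : ℕ => n)
      N hloc (tendsto_neg_atTop_atBot.comp tendsto_natCast_atTop_atTop)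
      tendsto_natCast_atTop_atTop (Eventually.of_forall fun n => key n n.cast_nonneg)
  refine ⟨hint, le_of_tendsto (intervalIntegral_tendsto_integral hint.norm
    (tendsto_neg_atTop_atBot.comp tendsto_natCast_atTop_atTop)
      (tendsto_natCast_atTop_atTop)) (Eventually.of_forall fun n : ℕ => ?_)⟩
  exact key n n.cast_nonneg

/-! ### Integrability on horizontal lines and of the derivative -/

section integrable

variable {τ : ℝ} {F : ℂ → ℂ}

/-- Restrictions of an integrable function of exponential type to horizontal lines. -/
theorem HasExpTypeAtMost.integrable_add (hτ : 0 ≤ τ) (hF : Differentiable ℂ F)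
    (hE : HasExpTypeAtMost τ F) (hi : Integrable (fun x : ℝ => F x)) (z : ℂ) :
    Integrable (fun x : ℝ => F (z + x)) ∧
      ∫ x : ℝ, ‖F (z + x)‖ ≤ (∫ x : ℝ, ‖F x‖) * Real.exp (τ * |z.im|) := by
  have hc := hF.continuous
  exact integrable_of_pairing_le (by fun_prop) fun φ hφ h1 R hR =>
    norm_integral_window_le hτ hF hE hi hφ h1 hR z

/-- The pairing of `F'` with `φ` is the derivative at `0` of the window integral of `F`, so Cauchy's
estimate on the unit circle bounds it uniformly in `R` and `φ`. -/
theorem HasExpTypeAtMost.integrable_deriv (hτ : 0 ≤ τ) (hF : Differentiable ℂ F)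
    (hE : HasExpTypeAtMost τ F) (hi : Integrable (fun x : ℝ => F x)) :
    Integrable (fun x : ℝ => deriv F x) := by
  have hc := continuous_deriv_of_entire hF
  refine (integrable_of_pairing_le (N := (∫ x : ℝ, ‖F x‖) * Real.exp τ) (by fun_prop)
    fun φ hφ h1 R hR => ?_).1
  have hd := hasDerivAt_integral_window hF hφ R 0
  have := Complex.norm_deriv_le_of_forall_mem_sphere_norm_le (c := 0) one_pos
    (f := fun w => ∫ t in -R..R, F (w + t) * φ t)
    (Differentiable.diffContOnCl fun w => (hasDerivAt_integral_window hF hφ R w).differentiableAt)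
    (C := (∫ x : ℝ, ‖F x‖) * Real.exp τ) fun w hw => ?_
  · rw [hd.deriv] at this
    simpa using this
  · refine (norm_integral_window_le hτ hF hE hi hφ h1 hR w).trans ?_
    have : |w.im| ≤ 1 := (Complex.abs_im_le_norm w).trans (by simpa using hw.le)
    gcongr
    nlinarith

theorem hasDerivAt_ofReal_comp (hF : Differentiable ℂ F) (x : ℝ) :
    HasDerivAt (fun t : ℝ => F t) (deriv F x) x := (hF x).hasDerivAt.comp_ofReal

theorem HasExpTypeAtMost.tendsto_atTop (hτ : 0 ≤ τ) (hF : Differentiable ℂ F)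
    (hE : HasExpTypeAtMost τ F) (hi : Integrable (fun x : ℝ => F x)) :
    Tendsto (fun x : ℝ => F x) atTop (𝓝 0) :=
  tendsto_zero_of_hasDerivAt_of_integrableOn_Ioi (a := 0) (f' := fun x : ℝ => deriv F x)
    (fun x _ => hasDerivAt_ofReal_comp hF x)
    (hE.integrable_deriv hτ hF hi).integrableOn hi.integrableOn

theorem HasExpTypeAtMost.tendsto_atBot (hτ : 0 ≤ τ) (hF : Differentiable ℂ F)
    (hE : HasExpTypeAtMost τ F) (hi : Integrable (fun x : ℝ => F x)) :
    Tendsto (fun x : ℝ => F x) atBot (𝓝 0) :=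
  tendsto_zero_of_hasDerivAt_of_integrableOn_Iic (a := 0) (f' := fun x : ℝ => deriv F x)
    (fun x _ => hasDerivAt_ofReal_comp hF x)
    (hE.integrable_deriv hτ hF hi).integrableOn hi.integrableOn

end integrable

/-! ### Contour shift, Paley–Wiener and Poisson summation -/

section poisson

variable {τ : ℝ} {F : ℂ → ℂ}

/-- This is Cauchy's theorem on a rectangle, obtained by differentiating the window integral in the
height: its complex derivative is `F (z + R) - F (z - R)`, the contribution of the vertical sides.
-/
theorem integral_window_sub_eq (hF : Differentiable ℂ F) (R y : ℝ) :
    (∫ t in -R..R, F (y * Complex.I + t)) - ∫ t in -R..R, F t =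
      ∫ v in (0 : ℝ)..y, (F (v * Complex.I + R) - F (v * Complex.I - R)) * Complex.I := by
  have hc := hF.continuous
  have hd := continuous_deriv_of_entire hF
  have h1 : ∀ z, HasDerivAt (fun w => ∫ t in -R..R, F (w + t)) (F (z + R) - F (z - R)) z := by
    intro z
    have h2 := hasDerivAt_integral_window hF (φ := fun _ => 1) continuous_const R z
    simp only [mul_one] at h2
    convert h2 using 1
    rw [intervalIntegral.integral_eq_sub_of_hasDerivAt (f := fun t : ℝ => F (z + t))
      (fun t _ => ?_) (Continuous.intervalIntegrable (by fun_prop) _ _)]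
    · push_cast; ring_nf
    · exact ((hF (z + t)).hasDerivAt.comp_const_add z (t : ℂ)).comp_ofReal
  have h3 : ∀ v : ℝ, HasDerivAt (fun v : ℝ => ∫ t in -R..R, F (v * Complex.I + t))
      ((F (v * Complex.I + R) - F (v * Complex.I - R)) * Complex.I) v := fun v => by
    have := (h1 (v * Complex.I)).comp (v : ℂ) ((hasDerivAt_id (v : ℂ)).mul_const Complex.I)
    simpa [Function.comp_def] using this.comp_ofReal
  rw [intervalIntegral.integral_eq_sub_of_hasDerivAt (fun v _ => h3 v)
    (Continuous.intervalIntegrable (by fun_prop) _ _)]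
  simp

/-- The fundamental theorem of calculus gives `|F x| ≤ |F t| + ∫ |F'|` for every `t` in the
interval; averaging over `t` gives the claim because the length is at least `1`. -/
theorem norm_le_integral_add_integral_deriv (hF : Differentiable ℂ F) {a b x : ℝ}
    (hab : a + 1 ≤ b) (hx : x ∈ Icc a b) :
    ‖F x‖ ≤ ∫ t in a..b, (‖F t‖ + ‖deriv F t‖) := by
  have hc := hF.continuous
  have hd := continuous_deriv_of_entire hF
  set D := ∫ t in a..b, ‖deriv F t‖ with hD
  have hD0 : 0 ≤ D := intervalIntegral.integral_nonneg (by linarith) fun _ _ => norm_nonneg _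
  have h1 : ∀ t ∈ Icc a b, ‖F x‖ ≤ ‖F t‖ + D := fun t ht => by
    have h2 : ∫ s in t..x, deriv F s = F x - F t :=
      intervalIntegral.integral_eq_sub_of_hasDerivAt (f := fun t : ℝ => F t)
        (fun s _ => hasDerivAt_ofReal_comp hF s)
        (Continuous.intervalIntegrable (by fun_prop) _ _)
    have h3 : ‖F x - F t‖ ≤ D := by
      rw [← h2]
      refine intervalIntegral.norm_integral_le_integral_norm_uIoc.trans ?_
      rw [hD, intervalIntegral.integral_of_le (by linarith)]
      refine setIntegral_mono_set ?_ (Eventually.of_forall fun _ => norm_nonneg _) ?_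
      · exact (Continuous.integrableOn_Icc (by fun_prop)).mono_set Ioc_subset_Icc_self
      · refine LE.le.eventuallyLE ?_
        rw [uIoc]
        exact Ioc_subset_Ioc (le_min ht.1 hx.1) (max_le ht.2 hx.2)
    calc ‖F x‖ = ‖F t + (F x - F t)‖ := by congr 1; ring
      _ ≤ _ := (norm_add_le _ _).trans (by gcongr)
  have h4 : ∫ t in a..b, ‖F x‖ ≤ ∫ t in a..b, (‖F t‖ + D) :=
    intervalIntegral.integral_mono_on (by linarith) intervalIntegrable_const
      (Continuous.intervalIntegrable (by fun_prop) _ _) h1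
  have hi1 : IntervalIntegrable (fun t : ℝ => ‖F t‖) volume a b :=
    Continuous.intervalIntegrable (by fun_prop) _ _
  have hi2 : IntervalIntegrable (fun t : ℝ => ‖deriv F t‖) volume a b :=
    Continuous.intervalIntegrable (by fun_prop) _ _
  rw [intervalIntegral.integral_const, intervalIntegral.integral_add hi1 intervalIntegrable_const,
    intervalIntegral.integral_const, smul_eq_mul, smul_eq_mul] at h4
  rw [intervalIntegral.integral_add hi1 hi2, ← hD]
  have h5 : 0 ≤ ∫ t in a..b, ‖F t‖ :=
    intervalIntegral.integral_nonneg (by linarith) fun _ _ => norm_nonneg _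
  have h6 : 1 ≤ b - a := by linarith
  by_contra hlt
  push Not at hlt
  nlinarith

theorem HasExpTypeAtMost.exists_bound (hτ : 0 ≤ τ) (hF : Differentiable ℂ F)
    (hE : HasExpTypeAtMost τ F) (hi : Integrable (fun x : ℝ => F x)) :
    ∃ M : ℝ, 0 ≤ M ∧ ∀ z : ℂ, ‖F z‖ ≤ M * Real.exp (τ * |z.im|) := by
  have hid := hE.integrable_deriv hτ hF hi
  have hg := hi.norm.add hid.norm
  refine ⟨∫ t : ℝ, (‖F t‖ + ‖deriv F t‖), integral_nonneg fun _ => by positivity,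
    hE.norm_le_of_bounded hF fun x => ?_⟩
  refine (norm_le_integral_add_integral_deriv hF (a := x) (b := x + 1) le_rfl
    ⟨le_rfl, by linarith⟩).trans ?_
  rw [intervalIntegral.integral_of_le (by linarith)]
  exact setIntegral_le_integral hg (Eventually.of_forall fun _ => by
    simp only [Pi.zero_apply]; positivity)

/-- Shifting the line of integration of an integrable function of exponential type. -/
theorem HasExpTypeAtMost.integral_shift (hτ : 0 ≤ τ) (hF : Differentiable ℂ F)
    (hE : HasExpTypeAtMost τ F) (hi : Integrable (fun x : ℝ => F x)) (y : ℝ) :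
    ∫ x : ℝ, F (y * Complex.I + x) = ∫ x : ℝ, F x := by
  have hc := hF.continuous
  have hN : Tendsto (fun n : ℕ => (n : ℝ)) atTop atTop := tendsto_natCast_atTop_atTop
  have h1 := intervalIntegral_tendsto_integral (hE.integrable_add hτ hF hi (y * Complex.I)).1
    (tendsto_neg_atTop_atBot.comp hN) hN
  have h2 := intervalIntegral_tendsto_integral hi (tendsto_neg_atTop_atBot.comp hN) hN
  have h3 := h1.sub h2
  simp only [Function.comp_apply, integral_window_sub_eq hF] at h3
  obtain ⟨M, hM0, hM⟩ := hE.exists_bound hτ hF hi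
  -- The vertical sides disappear: `F` tends to `0` at both ends of each horizontal line and is
  -- dominated by `M * exp (τ |v|)`.
  have h4 : Tendsto (fun n : ℕ => ∫ v in (0 : ℝ)..y,
      (F (v * Complex.I + (n : ℝ)) - F (v * Complex.I - (n : ℝ))) * Complex.I) atTop
      (𝓝 (∫ v in (0 : ℝ)..y, (0 : ℂ))) := by
    refine intervalIntegral.tendsto_integral_filter_of_dominated_convergence
      (fun v => M * Real.exp (τ * |v|) + M * Real.exp (τ * |v|))
      (Eventually.of_forall fun n => Continuous.aestronglyMeasurable (by fun_prop))
      (Eventually.of_forall fun n => Eventually.of_forall fun v _ => ?_)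
      (Continuous.intervalIntegrable (by fun_prop) _ _)
      (Eventually.of_forall fun v _ => ?_)
    · rw [norm_mul, Complex.norm_I, mul_one]
      refine (norm_sub_le _ _).trans (add_le_add ?_ ?_)
      · simpa using hM (v * Complex.I + (n : ℝ))
      · simpa using hM (v * Complex.I - (n : ℝ))
    · have hFv : Differentiable ℂ (fun z => F (z + v * Complex.I)) :=
        hF.comp (differentiable_id.add_const _)
      have hiv : Integrable (fun x : ℝ => F (x + v * Complex.I)) := by
        simpa only [add_comm] using (hE.integrable_add hτ hF hi (v * Complex.I)).1
      have hEv := hE.comp_add hτ (v * Complex.I)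
      have ha := (hEv.tendsto_atTop hτ hFv hiv).comp hN
      have hb := (hEv.tendsto_atBot hτ hFv hiv).comp (tendsto_neg_atTop_atBot.comp hN)
      simp only [Function.comp_def] at ha hb
      have := (ha.sub hb).mul_const Complex.I
      simp only [sub_self, zero_mul] at this
      refine this.congr fun n => ?_
      push_cast
      ring_nf
  have := tendsto_nhds_unique h3 h4
  rw [intervalIntegral.integral_zero] at this
  exact sub_eq_zero.1 this

theorem fourier_eq_integral_cexp (f : ℝ → ℂ) (ξ : ℝ) :
    𝓕 f ξ = ∫ x : ℝ, f x * Complex.exp (-(2 * Real.pi * ξ * Complex.I) * x) := by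
  rw [Real.fourier_real_eq_integral_exp_smul]
  refine integral_congr_ae (Eventually.of_forall fun x => ?_)
  simp only [smul_eq_mul]
  rw [mul_comm]
  congr 2
  push_cast
  ring

theorem norm_cexp_modulation (ξ : ℝ) (z : ℂ) :
    ‖Complex.exp (-(2 * Real.pi * ξ * Complex.I) * z)‖ = Real.exp (2 * Real.pi * ξ * z.im) := by
  rw [Complex.norm_exp]
  congr 1
  simp

theorem norm_cexp_modulation_ofReal (ξ x : ℝ) :
    ‖Complex.exp (-(2 * Real.pi * ξ * Complex.I) * x)‖ = 1 := by
  rw [norm_cexp_modulation]; simp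

theorem continuous_fourier_of_integrable {f : ℝ → ℂ} (hf : Integrable f) : Continuous (𝓕 f) :=
  VectorFourier.fourierIntegral_continuous Real.continuous_fourierChar
    continuous_inner hf

variable {Δ : ℝ}

theorem differentiable_modulation (hF : Differentiable ℂ F) (ξ : ℝ) :
    Differentiable ℂ (fun z => F z * Complex.exp (-(2 * Real.pi * ξ * Complex.I) * z)) :=
  hF.mul (by fun_prop)

theorem HasExpTypeAtMost.modulation (hE : HasExpTypeAtMost (2 * Real.pi * Δ) F) (ξ : ℝ) :
    HasExpTypeAtMost (2 * Real.pi * (Δ + |ξ|))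
      (fun z => F z * Complex.exp (-(2 * Real.pi * ξ * Complex.I) * z)) := by
  have := hE.mul (hasExpTypeAtMost_cexp (-(2 * Real.pi * ξ * Complex.I)))
  rw [show 2 * Real.pi * (Δ + |ξ|) = 2 * Real.pi * Δ + ‖-(2 * Real.pi * ξ * Complex.I)‖ by
    simp [Real.pi_pos.le, abs_of_nonneg]; ring]
  exact this

theorem integrable_modulation (hF : Differentiable ℂ F) (hi : Integrable (fun x : ℝ => F x))
    (ξ : ℝ) :
    Integrable (fun x : ℝ => F x * Complex.exp (-(2 * Real.pi * ξ * Complex.I) * x)) := by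
  refine hi.mono (Continuous.aestronglyMeasurable ?_) (Eventually.of_forall fun x => ?_)
  · exact (differentiable_modulation hF ξ).continuous.comp Complex.continuous_ofReal
  · rw [norm_mul, norm_cexp_modulation_ofReal, mul_one]

/-- Moving the line of integration to height `y` multiplies the exponential by `exp (2πξy)` and the
`L¹` norm of `F` by at most `exp (2πΔ|y|)`. -/
theorem HasExpTypeAtMost.norm_fourier_le (hΔ : 0 ≤ Δ) (hF : Differentiable ℂ F)
    (hE : HasExpTypeAtMost (2 * Real.pi * Δ) F) (hi : Integrable (fun x : ℝ => F x)) (ξ y : ℝ) :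
    ‖𝓕 (fun x : ℝ => F x) ξ‖ ≤
      (∫ x : ℝ, ‖F x‖) * Real.exp (2 * Real.pi * (Δ * |y| + ξ * y)) := by
  have hpi := Real.pi_pos
  rw [fourier_eq_integral_cexp, ← (hE.modulation ξ).integral_shift (by positivity)
    (differentiable_modulation hF ξ) (integrable_modulation hF hi ξ) y]
  refine (norm_integral_le_integral_norm _).trans ?_
  have h1 : ∀ x : ℝ, ‖F (y * Complex.I + x) *
      Complex.exp (-(2 * Real.pi * ξ * Complex.I) * (y * Complex.I + x))‖ =
      ‖F (y * Complex.I + x)‖ * Real.exp (2 * Real.pi * ξ * y) := fun x => by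
    rw [norm_mul, norm_cexp_modulation]; simp
  simp_rw [h1]
  rw [integral_mul_const]
  have h2 := (hE.integrable_add (by positivity) hF hi (y * Complex.I)).2
  calc _ ≤ _ := mul_le_mul_of_nonneg_right h2 (Real.exp_pos _).le
    _ = _ := by
      rw [mul_assoc, ← Real.exp_add]
      congr 2
      simp
      ring

/-- Paley–Wiener: the Fourier transform of an integrable function of type `2πΔ` is supported in
`[-Δ, Δ]` and vanishes at the end points. -/
theorem HasExpTypeAtMost.fourier_eq_zero (hΔ : 0 < Δ) (hF : Differentiable ℂ F)
    (hE : HasExpTypeAtMost (2 * Real.pi * Δ) F) (hi : Integrable (fun x : ℝ => F x)) {ξ : ℝ}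
    (hξ : Δ ≤ |ξ|) : 𝓕 (fun x : ℝ => F x) ξ = 0 := by
  have hpi := Real.pi_pos
  -- Outside the closed interval the height is sent to infinity with the sign opposite to `ξ`.
  have h1 : ∀ ξ : ℝ, Δ < |ξ| → 𝓕 (fun x : ℝ => F x) ξ = 0 := fun ξ hξ => by
    have h2 : ∀ t : ℝ, 0 ≤ t → ‖𝓕 (fun x : ℝ => F x) ξ‖ ≤
        (∫ x : ℝ, ‖F x‖) * Real.exp (-(2 * Real.pi * (|ξ| - Δ) * t)) := fun t ht => by
      rcases le_total 0 ξ with h0 | h0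
      · refine (hE.norm_fourier_le hΔ.le hF hi ξ (-t)).trans (le_of_eq ?_)
        rw [abs_neg, abs_of_nonneg ht, abs_of_nonneg h0]
        ring_nf
      · refine (hE.norm_fourier_le hΔ.le hF hi ξ t).trans (le_of_eq ?_)
        rw [abs_of_nonneg ht, abs_of_nonpos h0]
        ring_nf
    have h3 : Tendsto (fun t : ℝ => (∫ x : ℝ, ‖F x‖) *
        Real.exp (-(2 * Real.pi * (|ξ| - Δ) * t))) atTop (𝓝 ((∫ x : ℝ, ‖F x‖) * 0)) := by
      refine tendsto_const_nhds.mul (Real.tendsto_exp_neg_atTop_nhds_zero.comp ?_)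
      exact tendsto_id.const_mul_atTop (by have := sub_pos.2 hξ; positivity)
    rw [mul_zero] at h3
    have h4 := ge_of_tendsto h3 ((eventually_ge_atTop 0).mono h2)
    exact norm_le_zero_iff.1 h4
  have hcl : IsClosed {x : ℝ | 𝓕 (fun x : ℝ => F x) x = 0} :=
    isClosed_eq (continuous_fourier_of_integrable hi) continuous_const
  -- The end points `|ξ| = Δ` are reached by continuity from outside.
  have h5 : ∀ n : ℕ, 𝓕 (fun x : ℝ => F x) (ξ * (1 + 1 / ((n : ℝ) + 1))) = 0 := fun n => by
    refine h1 _ ?_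
    have hp : 0 < 1 / ((n : ℝ) + 1) := by positivity
    rw [abs_mul, abs_of_pos (by positivity : 0 < 1 + 1 / ((n : ℝ) + 1))]
    nlinarith
  have h6 : Tendsto (fun n : ℕ => ξ * (1 + 1 / ((n : ℝ) + 1))) atTop (𝓝 (ξ * (1 + 0))) :=
    (tendsto_one_div_add_atTop_nhds_zero_nat.const_add 1).const_mul ξ
  rw [add_zero, mul_one] at h6
  exact hcl.mem_of_tendsto h6 (Eventually.of_forall h5)

/-- This is the hypothesis of Poisson summation. The supremum over a translate of `K` is bounded by
the integral of `|F| + |F'|` over a window of length `2N`; cut into unit intervals, the windows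
cover the line `2N` times. -/
theorem summable_norm_restrict_translates (hF : Differentiable ℂ F)
    (hi : Integrable (fun x : ℝ => F x)) (hid : Integrable (fun x : ℝ => deriv F x))
    (f : C(ℝ, ℂ)) (hf : ∀ x : ℝ, f x = F x) (K : TopologicalSpace.Compacts ℝ) :
    Summable fun n : ℤ => ‖(f.comp (ContinuousMap.addRight (n : ℝ))).restrict K‖ := by
  have hc := hF.continuous
  have hd := continuous_deriv_of_entire hF
  obtain ⟨r, hr⟩ := K.isCompact.isBounded.subset_closedBall 0
  obtain ⟨N, hN⟩ := exists_nat_ge (max r 1)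
  have hrN : r ≤ N := (le_max_left _ _).trans hN
  have h1N : (1 : ℝ) ≤ N := (le_max_right _ _).trans hN
  set g : ℝ → ℝ := fun t => ‖F t‖ + ‖deriv F t‖ with hg
  have hgi : Integrable g := hi.norm.add hid.norm
  have hgc : Continuous g := by fun_prop
  have hs : Summable fun n : ℤ => ∫ t in ((n : ℝ) - N)..(n + N), g t := by
    have h1 : ∀ n : ℤ, ∫ t in ((n : ℝ) - N)..(n + N), g t =
        ∑ k ∈ Finset.range (2 * N), ∫ t in ((k : ℝ) - N + n)..((k : ℝ) - N + n + 1), g t := by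
      intro n
      have := intervalIntegral.sum_integral_adjacent_intervals (f := g) (μ := volume)
        (a := fun k : ℕ => (k : ℝ) - N + n) (n := 2 * N)
        fun k _ => hgc.intervalIntegrable _ _
      rw [show (n : ℝ) - N = ((0 : ℕ) : ℝ) - N + n by push_cast; ring,
        show (n : ℝ) + N = ((2 * N : ℕ) : ℝ) - N + n by push_cast; ring, ← this]
      refine Finset.sum_congr rfl fun k _ => ?_
      congr 1
      push_cast
      ring
    simp_rw [h1]
    exact summable_sum fun k _ => (hgi.hasSum_intervalIntegral ((k : ℝ) - N)).summable
  refine Summable.of_nonneg_of_le (fun _ => norm_nonneg _) (fun n => ?_) hs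
  rw [ContinuousMap.norm_le _ (intervalIntegral.integral_nonneg (by linarith) fun t _ => by
    simp only [hg]; positivity)]
  rintro ⟨x, hx⟩
  have hx' := hr hx
  rw [mem_closedBall_zero_iff, Real.norm_eq_abs, abs_le] at hx'
  simp only [ContinuousMap.restrict_apply, ContinuousMap.comp_apply, ContinuousMap.coe_addRight, hf]
  exact norm_le_integral_add_integral_deriv hF (by linarith)
    ⟨by linarith, by linarith⟩

/-- Poisson summation for integrable functions of exponential type. -/
theorem HasExpTypeAtMost.poisson (hΔ : 0 < Δ) (hF : Differentiable ℂ F)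
    (hE : HasExpTypeAtMost (2 * Real.pi * Δ) F) (hi : Integrable (fun x : ℝ => F x)) :
    Summable (fun n : ℤ => F n) ∧ ∑' n : ℤ, F n = ∑' n : ℤ, 𝓕 (fun x : ℝ => F x) n := by
  have hpi := Real.pi_pos
  have hid := hE.integrable_deriv (by positivity) hF hi
  let f : C(ℝ, ℂ) := ⟨fun x : ℝ => F x, hF.continuous.comp Complex.continuous_ofReal⟩
  have hsum := summable_norm_restrict_translates hF hi hid f fun _ => rfl
  have hfs : Summable fun n : ℤ => 𝓕 (f : ℝ → ℂ) n := by
    obtain ⟨N, hN⟩ := exists_nat_ge Δ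
    refine summable_of_ne_finset_zero (s := Finset.Icc (-(N : ℤ)) N) fun n hn => ?_
    refine hE.fourier_eq_zero hΔ hF hi ?_
    rw [Finset.mem_Icc, ← abs_le, not_le] at hn
    have h1 : ((N : ℤ) : ℝ) < ((|n| : ℤ) : ℝ) := by exact_mod_cast hn
    push_cast at h1
    linarith
  constructor
  · refine Summable.of_norm ?_
    refine Summable.of_nonneg_of_le (fun _ => norm_nonneg _) (fun n => ?_)
      (hsum ⟨{0}, isCompact_singleton⟩)
    have := ((f.comp (ContinuousMap.addRight (n : ℝ))).restrict
      (⟨{0}, isCompact_singleton⟩ : TopologicalSpace.Compacts ℝ)).norm_coe_le_norm ⟨0, by simp⟩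
    simpa [f] using this
  · have := Real.tsum_eq_tsum_fourier hsum hfs 0
    simpa [f] using this

theorem HasExpTypeAtMost.hasSum_int (hF : Differentiable ℂ F)
    (hE : HasExpTypeAtMost (2 * Real.pi) F) (hi : Integrable (fun x : ℝ => F x)) :
    HasSum (fun n : ℤ => F n) (∫ x : ℝ, F x) := by
  rw [← mul_one (2 * Real.pi)] at hE
  obtain ⟨hs, he⟩ := hE.poisson one_pos hF hi
  have h0 : ∑' n : ℤ, 𝓕 (fun x : ℝ => F x) n = ∫ x : ℝ, F x := by
    rw [tsum_eq_single 0 fun n hn => hE.fourier_eq_zero one_pos hF hi ?_]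
    · simp [fourier_eq_integral_cexp]
    · exact_mod_cast Int.one_le_abs hn
  rw [← h0, ← he]
  exact hs.hasSum

/-- Modulation moves the dual points to `n + ξ`. Of these only `ξ` and `ξ - 1` can lie strictly
inside `(-1, 1)`. -/
theorem HasExpTypeAtMost.poisson_modulation (hF : Differentiable ℂ F)
    (hE : HasExpTypeAtMost (2 * Real.pi) F) (hi : Integrable (fun x : ℝ => F x)) {ξ : ℝ}
    (hξ : ξ ∈ Icc (0 : ℝ) 1) :
    ∑' n : ℤ, F n * Complex.exp (-(2 * Real.pi * ξ * Complex.I) * n) =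
      𝓕 (fun x : ℝ => F x) ξ + 𝓕 (fun x : ℝ => F x) (ξ - 1) := by
  rw [← mul_one (2 * Real.pi)] at hE
  have h1 := ((hE.modulation ξ).poisson (by positivity) (differentiable_modulation hF ξ)
    (integrable_modulation hF hi ξ)).2
  have h2 : ∀ η : ℝ, 𝓕 (fun x : ℝ => F x * Complex.exp (-(2 * Real.pi * ξ * Complex.I) * x)) η =
      𝓕 (fun x : ℝ => F x) (η + ξ) := fun η => by
    rw [fourier_eq_integral_cexp, fourier_eq_integral_cexp]
    refine integral_congr_ae (Eventually.of_forall fun x => ?_)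
    simp only
    rw [mul_assoc, ← Complex.exp_add]
    congr 2
    push_cast
    ring
  simp_rw [h2] at h1
  rw [h1, tsum_eq_sum (s := {0, -1}) fun n hn => hE.fourier_eq_zero one_pos hF hi ?_]
  · rw [Finset.sum_pair (by norm_num)]
    push_cast
    rw [zero_add, neg_add_eq_sub]
  · simp only [Finset.mem_insert, Finset.mem_singleton, not_or] at hn
    rcases lt_or_ge n 0 with h | h
    · have : n ≤ -2 := by lia
      have : (n : ℝ) ≤ -2 := by exact_mod_cast this
      rw [abs_of_nonpos (by linarith [hξ.2])]
      linarith [hξ.2]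
    · have : 1 ≤ n := by lia
      have : (1 : ℝ) ≤ n := by exact_mod_cast this
      rw [abs_of_nonneg (by linarith [hξ.1])]
      linarith [hξ.1]

/-- An integrable function of type `2π` vanishing at the integers, doubly so away from the origin,
is zero. -/
theorem HasExpTypeAtMost.eq_zero_of_zeros (hF : Differentiable ℂ F)
    (hE : HasExpTypeAtMost (2 * Real.pi) F) (hi : Integrable (fun x : ℝ => F x))
    (h0 : ∀ n : ℤ, F n = 0) (h1 : ∀ n : ℤ, n ≠ 0 → deriv F n = 0) : F = 0 := by
  have hpi := Real.pi_pos
  have hid := hE.integrable_deriv (by positivity) hF hi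
  have hEd := hE.of_deriv (by positivity) hF
  have hderiv : Differentiable ℂ (deriv F) :=
    fun z => (hF.analyticAt z).deriv.differentiableAt
  have hd : deriv (fun x : ℝ => F x) = fun x : ℝ => deriv F x :=
    funext fun x => (hasDerivAt_ofReal_comp hF x).deriv
  have hfd : ∀ ξ : ℝ, 𝓕 (fun x : ℝ => deriv F x) ξ =
      2 * Real.pi * Complex.I * ξ * 𝓕 (fun x : ℝ => F x) ξ := fun ξ => by
    have := Real.fourier_deriv hi (fun x => (hasDerivAt_ofReal_comp hF x).differentiableAt)
      (by rwa [hd])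
    rw [hd] at this
    simpa using congrFun this ξ
  have ha : ∀ ξ ∈ Icc (0 : ℝ) 1, 𝓕 (fun x : ℝ => F x) ξ + 𝓕 (fun x : ℝ => F x) (ξ - 1) = 0 := by
    intro ξ hξ
    rw [← hE.poisson_modulation hF hi hξ]
    simp [h0]
  -- For `F'` the two terms carry the factors `ξ` and `ξ - 1`. By `ha` the transforms at `ξ` and `ξ
  -- - 1` are opposite, so the sum collapses to the transform at `ξ` alone, which is therefore
  -- constant on `[0, 1]`.
  have hb : ∀ ξ ∈ Icc (0 : ℝ) 1,
      2 * Real.pi * Complex.I * 𝓕 (fun x : ℝ => F x) ξ = deriv F 0 := by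
    intro ξ hξ
    have h2 := hEd.poisson_modulation hderiv hid hξ
    rw [tsum_eq_single 0 fun n hn => by rw [h1 n hn, zero_mul], hfd, hfd] at h2
    simp only [Int.cast_zero, mul_zero, Complex.exp_zero, mul_one] at h2
    rw [h2, eq_neg_of_add_eq_zero_right (ha ξ hξ)]
    push_cast
    ring
  have hE1 := hE
  rw [← mul_one (2 * Real.pi)] at hE1
  -- The constant is read off at `ξ = 1`, where the transform vanishes.
  have hd0 : deriv F 0 = 0 := by
    rw [← hb 1 (by simp), hE1.fourier_eq_zero one_pos hF hi (by simp), mul_zero]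
  have hc : ∀ ξ ∈ Icc (0 : ℝ) 1, 𝓕 (fun x : ℝ => F x) ξ = 0 := fun ξ hξ => by
    have := hb ξ hξ
    rw [hd0] at this
    simpa using this
  have hall : 𝓕 (fun x : ℝ => F x) = 0 := by
    funext ξ
    rcases le_total 1 |ξ| with h | h
    · exact hE1.fourier_eq_zero one_pos hF hi h
    · obtain ⟨hl, hr⟩ := abs_le.1 h
      rcases le_total 0 ξ with h' | h'
      · exact hc ξ ⟨h', hr⟩
      · have hm : ξ + 1 ∈ Icc (0 : ℝ) 1 := ⟨by linarith, by linarith⟩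
        have := ha (ξ + 1) hm
        rwa [hc _ hm, zero_add, add_sub_cancel_right] at this
  have hreal : ∀ x : ℝ, F x = 0 := fun x => by
    have := Continuous.fourierInv_fourier_eq (hF.continuous.comp Complex.continuous_ofReal) hi
      (by rw [show (F ∘ Complex.ofReal) = fun x : ℝ => F x from rfl, hall]
          exact integrable_zero _ _ _)
    rw [show (F ∘ Complex.ofReal) = fun x : ℝ => F x from rfl, hall] at this
    rw [← show (fun x : ℝ => F x) x = F x from rfl, ← this, Real.fourierInv_eq]
    simp
  funext z
  have := hE.norm_le_of_bounded hF (M := 0) (fun x => by simp [hreal x]) z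
  simpa using this

end poisson

/-! ### The function `oddF`: sign, decay, integral and jump -/

theorem oddF_neg (x : ℝ) : oddF (-x) = -oddF x := by
  simp only [oddF, div_neg, Real.arctan_neg, neg_sq]
  ring

theorem sq_add_sq_pos_of_ne_zero {x : ℝ} (hx : x ≠ 0) (s : ℝ) : 0 < x ^ 2 + s ^ 2 := by
  positivity

theorem integral_zero_one_div_sq_add_sq (x : ℝ) :
    ∫ s in (0 : ℝ)..1, x / (x ^ 2 + s ^ 2) = Real.arctan (1 / x) := by
  rw [integral_div_sq_add_sq, zero_div, Real.arctan_zero, sub_zero]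

theorem oddF_nonneg {x : ℝ} (hx : 0 ≤ x) : 0 ≤ oddF x := by
  rcases hx.eq_or_lt with rfl | hx
  · simp [oddF]
  · rw [oddF, ← integral_zero_one_div_sq_add_sq x, sub_nonneg]
    have h : ∫ _ in (0 : ℝ)..1, x / (1 + x ^ 2) ≤ ∫ s in (0 : ℝ)..1, x / (x ^ 2 + s ^ 2) := by
      refine intervalIntegral.integral_mono_on zero_le_one intervalIntegrable_const ?_
        fun s hs => ?_
      · refine Continuous.intervalIntegrable (continuous_const.div (by fun_prop) fun s => ?_) _ _
        exact (sq_add_sq_pos_of_ne_zero hx.ne' s).ne'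
      · have := sq_add_sq_pos_of_ne_zero hx.ne' s
        exact div_le_div_of_nonneg_left hx.le this (by nlinarith [hs.1, hs.2])
    simpa using h

/-- For `x > 0`, multiplying by `1 + x²` leaves `arctan (1/x) + (x² arctan (1/x) - x)`, whose
bracket is nonpositive because `arctan (1/x) ≤ 1/x`. -/
theorem abs_oddF_le (x : ℝ) : |oddF x| ≤ Real.pi / 2 / (1 + x ^ 2) := by
  have key : ∀ x : ℝ, 0 ≤ x → |oddF x| ≤ Real.pi / 2 / (1 + x ^ 2) := fun x hx => by
    rw [abs_of_nonneg (oddF_nonneg hx), oddF, le_div_iff₀ (by positivity), sub_mul,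
      div_mul_cancel₀ _ (by positivity)]
    rcases hx.eq_or_lt with rfl | hx
    · simp
      positivity
    have h1 : Real.arctan (1 / x) ≤ 1 / x := by
      have h := integral_zero_one_div_sq_add_sq x
      rw [← h]
      have : ∫ s in (0 : ℝ)..1, x / (x ^ 2 + s ^ 2) ≤ ∫ s in (0 : ℝ)..1, 1 / x := by
        refine intervalIntegral.integral_mono_on zero_le_one ?_ intervalIntegrable_const
          fun s hs => ?_
        · refine Continuous.intervalIntegrable (continuous_const.div (by fun_prop) fun s => ?_) _ _
          exact (sq_add_sq_pos_of_ne_zero hx.ne' s).ne'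
        · have := sq_add_sq_pos_of_ne_zero hx.ne' s
          rw [div_le_div_iff₀ this hx]
          nlinarith
      simpa using this
    have h2 := (Real.arctan_lt_pi_div_two (1 / x)).le
    have h3 : Real.arctan (1 / x) * x ^ 2 ≤ x := by
      calc _ ≤ 1 / x * x ^ 2 := by gcongr
        _ = x := by field_simp
    linarith
  rcases le_total 0 x with hx | hx
  · exact key x hx
  · have := key (-x) (by linarith)
    rwa [oddF_neg, abs_neg, neg_sq] at this

theorem measurable_oddF : Measurable oddF := by
  unfold oddF
  fun_prop

theorem integrable_const_div_one_add_sq (C : ℝ) : Integrable (fun x : ℝ => C / (1 + x ^ 2)) := by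
  simp_rw [div_eq_mul_inv]
  exact integrable_inv_one_add_sq.const_mul C

theorem integrable_oddF : Integrable oddF :=
  (integrable_const_div_one_add_sq _).mono' measurable_oddF.aestronglyMeasurable
    (Eventually.of_forall abs_oddF_le)

theorem integral_oddF : ∫ x, oddF x = 0 := by
  have h := integral_neg_eq_self oddF volume
  simp_rw [oddF_neg] at h
  rw [integral_neg] at h
  linarith

theorem differentiableAt_oddF {x : ℝ} (hx : x ≠ 0) : DifferentiableAt ℝ oddF x := by
  unfold oddF
  refine DifferentiableAt.sub (DifferentiableAt.arctan ?_) ?_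
  · exact (differentiableAt_const _).div differentiableAt_id hx
  · exact differentiableAt_id.div (by fun_prop) (by positivity)

theorem tendsto_oddF_zero : Tendsto oddF (𝓝[>] 0) (𝓝 (Real.pi / 2)) := by
  have h1 : Tendsto (fun x : ℝ => Real.arctan (1 / x)) (𝓝[>] 0) (𝓝 (Real.pi / 2)) := by
    simp_rw [one_div]
    exact (Real.tendsto_arctan_atTop.mono_right nhdsWithin_le_nhds).comp tendsto_inv_nhdsGT_zero
  have h2 : Tendsto (fun x : ℝ => x / (1 + x ^ 2)) (𝓝[>] 0) (𝓝 (0 / (1 + 0 ^ 2))) :=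
    Tendsto.mono_left (Continuous.tendsto (continuous_id.div (by fun_prop)
      fun x => by positivity) 0) nhdsWithin_le_nhds
  rw [zero_div] at h2
  simpa only [sub_zero] using! h1.sub h2

/-! ### Optimality and uniqueness of majorants -/

section majorant

variable {Δ : ℝ} {K L : ℂ → ℂ}

theorem IsRealEntire.eq_ofReal (hK : IsRealEntire K) (x : ℝ) : K x = ((K x).re : ℂ) :=
  Complex.ext (by simp) (by simpa using hK.real x)

theorem IsRealEntire.continuous_re (hK : IsRealEntire K) : Continuous fun x : ℝ => (K x).re :=
  Complex.continuous_re.comp (hK.entire.continuous.comp Complex.continuous_ofReal)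

theorem IsRealEntire.hasDerivAt_re (hK : IsRealEntire K) (x : ℝ) :
    HasDerivAt (fun t : ℝ => (K t).re) (deriv K x).re x := by
  exact Complex.reCLM.hasFDerivAt.comp_hasDerivAt x (hasDerivAt_ofReal_comp hK.entire x)

theorem IsRealEntire.deriv_im (hK : IsRealEntire K) (x : ℝ) : (deriv K x).im = 0 := by
  have h : HasDerivAt (fun t : ℝ => (K t).im) (deriv K x).im x := by
    exact Complex.imCLM.hasFDerivAt.comp_hasDerivAt x (hasDerivAt_ofReal_comp hK.entire x)
  simp_rw [hK.real] at h
  exact h.unique (hasDerivAt_const x 0)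

theorem IsMajorant.pi_div_two_le (hK : IsMajorant Δ oddF K) : Real.pi / 2 ≤ (K 0).re := by
  have h1 : Tendsto (fun x : ℝ => (K x).re) (𝓝[>] 0) (𝓝 (K (0 : ℝ)).re) :=
    (hK.realEntire.continuous_re.tendsto 0).mono_left nhdsWithin_le_nhds
  rw [Complex.ofReal_zero] at h1
  exact le_of_tendsto_of_tendsto' tendsto_oddF_zero h1 hK.le

/-- The quadrature formula at the points `n / Δ` for integrable functions of type `2πΔ`. -/
theorem HasExpTypeAtMost.hasSum_div (hΔ : 0 < Δ) (hF : Differentiable ℂ K)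
    (hE : HasExpTypeAtMost (2 * Real.pi * Δ) K) (hi : Integrable (fun x : ℝ => K x)) :
    HasSum (fun n : ℤ => K ((n / Δ : ℝ) : ℂ)) (Δ * ∫ x : ℝ, K x) := by
  have hE' := hE.comp_mul_left (inv_pos.2 hΔ)
  rw [mul_inv_cancel_right₀ hΔ.ne'] at hE'
  have hi' : Integrable (fun x : ℝ => K (((Δ⁻¹ : ℝ) : ℂ) * x)) := by
    simpa using hi.comp_mul_left' (inv_pos.2 hΔ).ne'
  have := hE'.hasSum_int (hF.comp (differentiable_id.const_mul _)) hi'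
  convert this using 1
  · funext n
    congr 1
    push_cast
    rw [div_eq_inv_mul]
  · have h := Measure.integral_comp_mul_left (fun x : ℝ => K x) Δ⁻¹
    rw [inv_inv, abs_of_pos hΔ, Complex.real_smul] at h
    rw [← h]
    simp

/-- Pairing `n` with `-n` cancels the odd function. Subtracting `π`, twice the one-sided limit at
the jump, makes every term nonnegative. -/
theorem IsMajorant.hasSum_symm (hΔ : 0 < Δ) (hK : IsMajorant Δ oddF K)
    (hi : Integrable (fun x : ℝ => K x)) :
    HasSum (fun n : ℤ => (K ((n / Δ : ℝ) : ℂ)).re + (K ((-(n / Δ) : ℝ) : ℂ)).re -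
      if n = 0 then Real.pi else 0) (2 * (Δ * ∫ x : ℝ, (K x).re) - Real.pi) := by
  have h1 : HasSum (fun n : ℤ => (K ((n / Δ : ℝ) : ℂ)).re) (Δ * ∫ x : ℝ, (K x).re) := by
    have h := Complex.hasSum_re (hK.expType.hasSum_div hΔ hK.realEntire.entire hi)
    rwa [Complex.re_ofReal_mul, ← RCLike.re_eq_complex_re, ← integral_re hi] at h
  have h2 : HasSum (fun n : ℤ => (K ((-(n / Δ) : ℝ) : ℂ)).re) (Δ * ∫ x : ℝ, (K x).re) := by
    have := (Equiv.neg ℤ).hasSum_iff.2 h1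
    simpa [Function.comp_def, neg_div] using this
  rw [two_mul]
  exact (h1.add h2).sub (hasSum_ite_eq 0 Real.pi)

theorem IsMajorant.symm_term_nonneg (hK : IsMajorant Δ oddF K) (n : ℤ) :
    0 ≤ (K ((n / Δ : ℝ) : ℂ)).re + (K ((-(n / Δ) : ℝ) : ℂ)).re -
      if n = 0 then Real.pi else 0 := by
  split_ifs with h
  · subst h
    have := hK.pi_div_two_le
    simp
    linarith
  · have h1 := hK.le (n / Δ)
    have h2 := hK.le (-(n / Δ))
    rw [oddF_neg] at h2
    linarith

theorem IsMajorant.le_integral (hΔ : 0 < Δ) (hK : IsMajorant Δ oddF K)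
    (hi : Integrable (fun x : ℝ => K x)) : Real.pi / (2 * Δ) ≤ ∫ x : ℝ, (K x).re := by
  have := (hK.hasSum_symm hΔ hi).nonneg hK.symm_term_nonneg
  rw [div_le_iff₀ (by positivity)]
  linarith

/-- A vanishing sum of nonnegative terms has only zero terms. At a node other than `0`, the
difference `K - oddF` then attains its minimum `0` at a point of differentiability; at the jump no
derivative is available. -/
theorem IsMajorant.interpolates (hΔ : 0 < Δ) (hK : IsMajorant Δ oddF K)
    (hi : Integrable (fun x : ℝ => K x)) (hint : ∫ x : ℝ, (K x).re = Real.pi / (2 * Δ)) :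
    (K 0).re = Real.pi / 2 ∧ ∀ n : ℤ, n ≠ 0 → (K ((n / Δ : ℝ) : ℂ)).re = oddF (n / Δ) ∧
      (deriv K ((n / Δ : ℝ) : ℂ)).re = deriv oddF (n / Δ) := by
  have h0 := hK.hasSum_symm hΔ hi
  rw [hint, show 2 * (Δ * (Real.pi / (2 * Δ))) - Real.pi = 0 by field_simp; ring,
    hasSum_zero_iff_of_nonneg hK.symm_term_nonneg] at h0
  constructor
  · have := congrFun h0 0
    simp at this
    linarith
  · intro n hn
    have h1 := congrFun h0 n
    simp only [hn, if_false, Pi.zero_apply] at h1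
    have h2 := hK.le (n / Δ)
    have h3 := hK.le (-(n / Δ))
    rw [oddF_neg] at h3
    have h4 : (K ((n / Δ : ℝ) : ℂ)).re = oddF (n / Δ) := by linarith
    refine ⟨h4, ?_⟩
    have hx : (n / Δ : ℝ) ≠ 0 := div_ne_zero (by exact_mod_cast hn) hΔ.ne'
    have hd := (hK.realEntire.hasDerivAt_re (n / Δ)).sub (differentiableAt_oddF hx).hasDerivAt
    have hmin : IsLocalMin ((fun t : ℝ => (K t).re) - oddF) (n / Δ) :=
      Eventually.of_forall fun y => by
        simp only [Pi.sub_apply, h4, sub_self]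
        exact sub_nonneg.2 (hK.le y)
    exact sub_eq_zero.1 (hmin.hasDerivAt_eq_zero hd)

theorem IsMajorant.unique (hΔ : 0 < Δ) (hK : IsMajorant Δ oddF K)
    (hi : Integrable (fun x : ℝ => K x)) (hint : ∫ x : ℝ, (K x).re = Real.pi / (2 * Δ))
    (hL : IsMajorant Δ oddF L) (hi' : Integrable (fun x : ℝ => L x))
    (hint' : ∫ x : ℝ, (L x).re = Real.pi / (2 * Δ)) : K = L := by
  obtain ⟨hK0, hKn⟩ := hK.interpolates hΔ hi hint
  obtain ⟨hL0, hLn⟩ := hL.interpolates hΔ hi' hint'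
  have hdK := hK.realEntire.entire
  have hdL := hL.realEntire.entire
  have hd : Differentiable ℂ (fun z => K z - L z) := hdK.sub hdL
  have hE := (hK.expType.sub hL.expType).comp_mul_left (inv_pos.2 hΔ)
  rw [mul_inv_cancel_right₀ hΔ.ne'] at hE
  have hi'' : Integrable (fun x : ℝ =>
      K (((Δ⁻¹ : ℝ) : ℂ) * x) - L (((Δ⁻¹ : ℝ) : ℂ) * x)) := by
    simpa using (hi.sub hi').comp_mul_left' (inv_pos.2 hΔ).ne'
  have hcast : ∀ n : ℤ, ((Δ⁻¹ : ℝ) : ℂ) * n = ((n / Δ : ℝ) : ℂ) := fun n => by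
    push_cast; rw [div_eq_inv_mul]
  have hzero := HasExpTypeAtMost.eq_zero_of_zeros
    (F := fun z => K (((Δ⁻¹ : ℝ) : ℂ) * z) - L (((Δ⁻¹ : ℝ) : ℂ) * z))
    (hd.comp (differentiable_id.const_mul _)) hE hi''
    (fun n => ?_) (fun n hn => ?_)
  · funext z
    have := congrFun hzero (Δ * z)
    simp only [Pi.zero_apply, Complex.ofReal_inv] at this
    rw [inv_mul_cancel_left₀ (by exact_mod_cast hΔ.ne')] at this
    exact sub_eq_zero.1 this
  · rw [hcast, hK.realEntire.eq_ofReal, hL.realEntire.eq_ofReal]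
    rcases eq_or_ne n 0 with rfl | hn
    · simp [hK0, hL0]
    · rw [(hKn n hn).1, (hLn n hn).1, sub_self]
  · have h1 := ((hd (((Δ⁻¹ : ℝ) : ℂ) * n)).hasDerivAt.comp (n : ℂ)
      ((hasDerivAt_id (n : ℂ)).const_mul ((Δ⁻¹ : ℝ) : ℂ))).deriv
    simp only [Function.comp_def] at h1
    rw [h1, hcast, deriv_fun_sub (hdK _) (hdL _)]
    have h2 : deriv K ((n / Δ : ℝ) : ℂ) = deriv L ((n / Δ : ℝ) : ℂ) :=
      Complex.ext ((hKn n hn).2.trans (hLn n hn).2.symm)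
        ((hK.realEntire.deriv_im _).trans (hL.realEntire.deriv_im _).symm)
    rw [h2, sub_self, zero_mul]

theorem IsMajorant.norm_sub (hK : IsMajorant Δ oddF K) (x : ℝ) :
    ‖(oddF x : ℂ) - K x‖ = (K x).re - oddF x := by
  rw [hK.realEntire.eq_ofReal x, ← Complex.ofReal_sub, Complex.norm_real, Real.norm_eq_abs,
    abs_sub_comm, abs_of_nonneg]
  · simp
  · simpa using hK.le x

theorem IsMajorant.l1Dist_eq (hK : IsMajorant Δ oddF K) (hi : Integrable (fun x : ℝ => K x)) :
    l1Dist oddF K = ENNReal.ofReal (∫ x : ℝ, (K x).re) := by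
  have hre : Integrable (fun x : ℝ => (K x).re) := hi.re
  have h1 : ∫ x : ℝ, (K x).re = ∫ x : ℝ, ((K x).re - oddF x) := by
    rw [integral_sub hre integrable_oddF, integral_oddF, sub_zero]
  rw [h1, ofReal_integral_eq_lintegral_ofReal (f := fun x : ℝ => (K x).re - oddF x)
    (hre.sub integrable_oddF)
    (Eventually.of_forall fun x => sub_nonneg.2 (hK.le x)), l1Dist]
  refine lintegral_congr fun x => ?_
  rw [← ofReal_norm, hK.norm_sub]

theorem IsMajorant.integrable_of_l1Dist (hK : IsMajorant Δ oddF K) (h : l1Dist oddF K ≠ ⊤) :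
    Integrable (fun x : ℝ => K x) := by
  have h1 : Integrable (fun x : ℝ => (oddF x : ℂ) - K x) := by
    refine ⟨?_, lt_top_iff_ne_top.2 h⟩
    refine (Complex.measurable_ofReal.comp measurable_oddF).aestronglyMeasurable.sub ?_
    exact (hK.realEntire.entire.continuous.comp Complex.continuous_ofReal).aestronglyMeasurable
  refine ((integrable_oddF.ofReal (𝕜 := ℂ)).sub h1).congr (Eventually.of_forall fun x => ?_)
  simp

theorem IsMajorant.isExtremalMajorant (hΔ : 0 < Δ) (hK : IsMajorant Δ oddF K)
    (hi : Integrable (fun x : ℝ => K x)) (hint : ∫ x : ℝ, (K x).re = Real.pi / (2 * Δ)) :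
    IsExtremalMajorant Δ oddF K ∧ ∀ L, IsExtremalMajorant Δ oddF L → L = K := by
  refine ⟨⟨hK, fun L hL => ?_⟩, fun L hL => ?_⟩
  · by_cases h : l1Dist oddF L = ⊤
    · simp [h]
    · have hLi := hL.integrable_of_l1Dist h
      rw [hK.l1Dist_eq hi, hL.l1Dist_eq hLi, hint]
      exact ENNReal.ofReal_le_ofReal (hL.le_integral hΔ hLi)
  · have h1 := hL.2 K hK
    rw [hK.l1Dist_eq hi, hint] at h1
    -- An extremal competitor is at least as close as `K`, so its distance is finite and it is
    -- integrable.
    have hLi := hL.1.integrable_of_l1Dist (ne_top_of_le_ne_top ENNReal.ofReal_ne_top h1)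
    rw [hL.1.l1Dist_eq hLi, ENNReal.ofReal_le_ofReal_iff (by positivity)] at h1
    exact hL.1.unique hΔ hLi (le_antisymm h1 (hL.1.le_integral hΔ hLi)) hK hi hint

end majorant

/-! ### Reflection between majorants and minorants -/

section reflection

/-- The reflection `z ↦ -K(-z)`, which exchanges majorants and minorants of an odd function. -/
def oddReflect (K : ℂ → ℂ) : ℂ → ℂ := fun z => -K (-z)

variable {Δ : ℝ} {K : ℂ → ℂ}

theorem oddReflect_oddReflect (K : ℂ → ℂ) : oddReflect (oddReflect K) = K := by
  funext z; simp [oddReflect]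

theorem oddReflect_ofReal (K : ℂ → ℂ) (x : ℝ) : oddReflect K x = -K ((-x : ℝ) : ℂ) := by
  simp [oddReflect]

theorem IsRealEntire.oddReflect (hK : IsRealEntire K) : IsRealEntire (oddReflect K) where
  entire := (hK.entire.comp differentiable_neg).neg
  real x := by simpa [oddReflect_ofReal] using hK.real (-x)

theorem HasExpTypeAtMost.oddReflect {τ : ℝ} (hK : HasExpTypeAtMost τ K) :
    HasExpTypeAtMost τ (oddReflect K) := hK.comp_neg.neg

theorem IsMajorant.oddReflect (hK : IsMajorant Δ oddF K) : IsMinorant Δ oddF (oddReflect K) where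
  realEntire := hK.realEntire.oddReflect
  expType := hK.expType.oddReflect
  le x := by
    have := hK.le (-x)
    rw [oddF_neg] at this
    rw [oddReflect_ofReal, Complex.neg_re]
    linarith

theorem IsMinorant.oddReflect (hK : IsMinorant Δ oddF K) : IsMajorant Δ oddF (oddReflect K) where
  realEntire := hK.realEntire.oddReflect
  expType := hK.expType.oddReflect
  le x := by
    have := hK.le (-x)
    rw [oddF_neg] at this
    rw [oddReflect_ofReal, Complex.neg_re]
    linarith

theorem l1Dist_oddReflect (K : ℂ → ℂ) : l1Dist oddF (oddReflect K) = l1Dist oddF K := by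
  rw [l1Dist, l1Dist, ← lintegral_neg_eq_self]
  refine lintegral_congr fun x => ?_
  rw [oddReflect_ofReal, oddF_neg, neg_neg, ← enorm_neg]
  congr 1
  push_cast
  ring

theorem IsExtremalMajorant.oddReflect (hK : IsExtremalMajorant Δ oddF K) :
    IsExtremalMinorant Δ oddF (oddReflect K) :=
  ⟨hK.1.oddReflect, fun L hL => by
    rw [l1Dist_oddReflect, ← l1Dist_oddReflect L]
    exact hK.2 _ hL.oddReflect⟩

theorem IsExtremalMinorant.oddReflect (hK : IsExtremalMinorant Δ oddF K) :
    IsExtremalMajorant Δ oddF (oddReflect K) :=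
  ⟨hK.1.oddReflect, fun L hL => by
    rw [l1Dist_oddReflect, ← l1Dist_oddReflect L]
    exact hK.2 _ hL.oddReflect⟩

theorem integrable_oddReflect (hK : Integrable (fun x : ℝ => K x)) :
    Integrable (fun x : ℝ => oddReflect K x) := by
  simp_rw [oddReflect_ofReal]
  exact (hK.comp_neg).neg

end reflection

/-! ### Divided differences and the interpolating kernel -/

noncomputable section

/-- The divided difference `(g z - g a) / (z - a)`, as an integral that makes sense for `z = a`. -/
def divDiff (g : ℂ → ℂ) (a z : ℂ) : ℂ := ∫ t in (0 : ℝ)..1, deriv g (a + t * (z - a))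

section divDiff

variable {g : ℂ → ℂ}

theorem differentiable_deriv_of_entire (hg : Differentiable ℂ g) : Differentiable ℂ (deriv g) :=
  fun z => (hg.analyticAt z).deriv.differentiableAt

theorem sub_mul_divDiff (hg : Differentiable ℂ g) (a z : ℂ) :
    (z - a) * divDiff g a z = g z - g a := by
  have hc := continuous_deriv_of_entire hg
  have h1 : ∀ t : ℝ, HasDerivAt (fun t : ℝ => g (a + t * (z - a)))
      ((z - a) * deriv g (a + t * (z - a))) t := fun t => by
    have h2 : HasDerivAt (fun w : ℂ => a + w * (z - a)) (z - a) t := by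
      simpa using ((hasDerivAt_id (t : ℂ)).mul_const (z - a)).const_add a
    rw [mul_comm]
    exact ((hg (a + t * (z - a))).hasDerivAt.comp (t : ℂ) h2).comp_ofReal
  rw [divDiff, ← intervalIntegral.integral_const_mul,
    intervalIntegral.integral_eq_sub_of_hasDerivAt (fun t _ => h1 t)
      (Continuous.intervalIntegrable (by fun_prop) _ _)]
  simp

theorem continuous_divDiff (hg : Differentiable ℂ g) :
    Continuous fun p : ℂ × ℂ => divDiff g p.1 p.2 := by
  have hc := continuous_deriv_of_entire hg
  unfold divDiff
  refine intervalIntegral.continuous_parametric_intervalIntegral_of_continuous' ?_ _ _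
  simp only [Function.uncurry_def]
  fun_prop

/-- Differentiation under the integral sign covers `z = a` as well, so removable singularities need
no separate treatment. -/
theorem hasDerivAt_divDiff (hg : Differentiable ℂ g) (a z : ℂ) :
    HasDerivAt (divDiff g a) (∫ t in (0 : ℝ)..1, deriv (deriv g) (a + t * (z - a)) * t) z := by
  have hd := differentiable_deriv_of_entire hg
  have hc := hd.continuous
  have hc' := continuous_deriv_of_entire hd
  refine hasDerivAt_intervalIntegral_of_continuous (F := fun z t => deriv g (a + t * (z - a)))
    (F' := fun z t => deriv (deriv g) (a + t * (z - a)) * t) ?_ ?_ (fun w t => ?_) z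
  · simp only [Function.uncurry_def]; fun_prop
  · simp only [Function.uncurry_def]; fun_prop
  · have h2 : HasDerivAt (fun w : ℂ => a + t * (w - a)) t w := by
      simpa using (((hasDerivAt_id w).sub_const a).const_mul (t : ℂ)).const_add a
    exact (hd (a + t * (w - a))).hasDerivAt.comp w h2

theorem continuous_integral_deriv_deriv (hg : Differentiable ℂ g) :
    Continuous fun p : ℂ × ℂ =>
      ∫ t in (0 : ℝ)..1, deriv (deriv g) (p.1 + t * (p.2 - p.1)) * t := by
  have hc := continuous_deriv_of_entire (differentiable_deriv_of_entire hg)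
  refine intervalIntegral.continuous_parametric_intervalIntegral_of_continuous' ?_ _ _
  simp only [Function.uncurry_def]
  fun_prop

end divDiff

/-- The entire function `(sin (πΔz) / z)²`. -/
def sinDivSq (Δ : ℝ) (z : ℂ) : ℂ := divDiff (fun w => Complex.sin (Real.pi * Δ * w)) 0 z ^ 2

/-- The function `sinh (πΔs) / s` of a real variable. -/
def sinhDiv (Δ s : ℝ) : ℝ := ∫ t in (0 : ℝ)..1, Real.pi * Δ * Real.cosh (Real.pi * Δ * (t * s))

section sinDivSq

variable {Δ : ℝ}

theorem differentiable_sin_mul (Δ : ℝ) :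
    Differentiable ℂ fun w : ℂ => Complex.sin (Real.pi * Δ * w) := by fun_prop

theorem differentiable_sinDivSq (Δ : ℝ) : Differentiable ℂ (sinDivSq Δ) := fun z =>
  (hasDerivAt_divDiff (differentiable_sin_mul Δ) 0 z).differentiableAt.pow 2

theorem deriv_sin_mul (Δ : ℝ) (z : ℂ) :
    deriv (fun w : ℂ => Complex.sin (Real.pi * Δ * w)) z =
      Real.pi * Δ * Complex.cos (Real.pi * Δ * z) := by
  have h : HasDerivAt (fun w : ℂ => (Real.pi * Δ : ℂ) * w) (Real.pi * Δ) z := by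
    simpa using (hasDerivAt_id z).const_mul (Real.pi * Δ : ℂ)
  rw [h.csin.deriv, mul_comm]

theorem sq_mul_sinDivSq (Δ : ℝ) (z : ℂ) :
    z ^ 2 * sinDivSq Δ z = Complex.sin (Real.pi * Δ * z) ^ 2 := by
  have h := sub_mul_divDiff (differentiable_sin_mul Δ) 0 z
  rw [sinDivSq, ← mul_pow]
  simp only [sub_zero, mul_zero, Complex.sin_zero] at h
  rw [h]

theorem sinDivSq_zero (Δ : ℝ) : sinDivSq Δ 0 = ((Real.pi * Δ) ^ 2 : ℝ) := by
  simp [sinDivSq, divDiff, deriv_sin_mul]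

theorem sinDivSq_ofReal (Δ x : ℝ) (hx : x ≠ 0) :
    sinDivSq Δ x = ((Real.sin (Real.pi * Δ * x) / x) ^ 2 : ℝ) := by
  have h := sq_mul_sinDivSq Δ x
  have hx' : (x : ℂ) ^ 2 ≠ 0 := pow_ne_zero 2 (by exact_mod_cast hx)
  rw [← mul_right_inj' hx', h]
  push_cast
  rw [← mul_pow, mul_div_cancel₀ _ (by exact_mod_cast hx)]

theorem sinDivSq_mul_I (Δ s : ℝ) : sinDivSq Δ (s * Complex.I) = ((sinhDiv Δ s ^ 2 : ℝ) : ℂ) := by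
  rw [sinDivSq, sinhDiv, divDiff]
  push_cast
  rw [← intervalIntegral.integral_ofReal]
  congr 1
  refine intervalIntegral.integral_congr fun t _ => ?_
  simp only [deriv_sin_mul]
  push_cast
  rw [← Complex.cos_mul_I]
  ring_nf

theorem sinhDiv_neg (Δ s : ℝ) : sinhDiv Δ (-s) = sinhDiv Δ s := by
  simp [sinhDiv, Real.cosh_neg]

theorem continuous_sinhDiv (Δ : ℝ) : Continuous (sinhDiv Δ) := by
  unfold sinhDiv
  refine intervalIntegral.continuous_parametric_intervalIntegral_of_continuous' ?_ _ _
  simp only [Function.uncurry_def]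
  fun_prop

theorem sinhDiv_le_sinhDiv (hΔ : 0 < Δ) {s r : ℝ} (hs : 0 ≤ s) (hsr : s ≤ r) :
    sinhDiv Δ s ≤ sinhDiv Δ r := by
  have hpi := Real.pi_pos
  refine intervalIntegral.integral_mono_on zero_le_one
    (Continuous.intervalIntegrable (by fun_prop) _ _)
    (Continuous.intervalIntegrable (by fun_prop) _ _) fun t ht => ?_
  have ht0 := ht.1
  have hr := hs.trans hsr
  gcongr
  rw [Real.cosh_le_cosh, abs_of_nonneg (by positivity), abs_of_nonneg (by positivity)]
  gcongr

theorem le_sinhDiv (hΔ : 0 < Δ) (s : ℝ) : Real.pi * Δ ≤ sinhDiv Δ s := by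
  have h0 : sinhDiv Δ 0 = Real.pi * Δ := by simp [sinhDiv]
  rw [← h0]
  rcases le_total 0 s with h | h
  · exact sinhDiv_le_sinhDiv hΔ le_rfl h
  · rw [← sinhDiv_neg Δ s]
    exact sinhDiv_le_sinhDiv hΔ le_rfl (by linarith)

theorem sinhDiv_pos (hΔ : 0 < Δ) (s : ℝ) : 0 < sinhDiv Δ s :=
  lt_of_lt_of_le (by have := Real.pi_pos; positivity) (le_sinhDiv hΔ s)

theorem norm_sin_le_exp_norm (z : ℂ) : ‖Complex.sin z‖ ≤ Real.exp ‖z‖ := by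
  rw [Complex.sin, norm_div, norm_mul, Complex.norm_I, mul_one]
  have h1 : ‖Complex.exp (-z * Complex.I)‖ ≤ Real.exp ‖z‖ := by
    simpa using Complex.norm_exp_le_exp_norm (-z * Complex.I)
  have h2 : ‖Complex.exp (z * Complex.I)‖ ≤ Real.exp ‖z‖ := by
    simpa using Complex.norm_exp_le_exp_norm (z * Complex.I)
  have h3 := norm_sub_le (Complex.exp (-z * Complex.I)) (Complex.exp (z * Complex.I))
  have h4 : ‖(2 : ℂ)‖ = 2 := by simp
  rw [h4]
  linarith

theorem norm_sinDivSq_le (hΔ : 0 < Δ) {z : ℂ} (hz : 1 ≤ ‖z‖) :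
    ‖sinDivSq Δ z‖ ≤ Real.exp (2 * Real.pi * Δ * ‖z‖) := by
  have h := congrArg norm (sq_mul_sinDivSq Δ z)
  rw [norm_mul, norm_pow, norm_pow] at h
  have h1 := norm_sin_le_exp_norm (Real.pi * Δ * z)
  have h2 : ‖(Real.pi * Δ * z : ℂ)‖ = Real.pi * Δ * ‖z‖ := by
    rw [norm_mul, norm_mul, Complex.norm_real, Complex.norm_real,
      Real.norm_of_nonneg Real.pi_pos.le, Real.norm_of_nonneg hΔ.le]
  rw [h2] at h1
  calc ‖sinDivSq Δ z‖ ≤ ‖z‖ ^ 2 * ‖sinDivSq Δ z‖ :=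
        le_mul_of_one_le_left (norm_nonneg _) (one_le_pow₀ hz)
    _ = ‖Complex.sin (Real.pi * Δ * z)‖ ^ 2 := h
    _ ≤ Real.exp (Real.pi * Δ * ‖z‖) ^ 2 := by gcongr
    _ = _ := by rw [← Real.exp_nat_mul]; congr 1; push_cast; ring

theorem exists_sinDivSq_ofReal (hΔ : 0 < Δ) (x : ℝ) :
    ∃ p : ℝ, sinDivSq Δ x = p ∧ 0 ≤ p ∧ p ≤ (Real.pi * Δ) ^ 2 ∧ p * x ^ 2 ≤ 1 ∧
      p * x ^ 2 = Real.sin (Real.pi * Δ * x) ^ 2 := by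
  rcases eq_or_ne x 0 with rfl | hx
  · exact ⟨(Real.pi * Δ) ^ 2, by rw [← sinDivSq_zero]; simp, by positivity, le_rfl, by simp,
      by simp⟩
  · have h1 : (Real.sin (Real.pi * Δ * x) / x) ^ 2 * x ^ 2 = Real.sin (Real.pi * Δ * x) ^ 2 := by
      rw [← mul_pow, div_mul_cancel₀ _ hx]
    refine ⟨(Real.sin (Real.pi * Δ * x) / x) ^ 2, sinDivSq_ofReal Δ x hx, by positivity, ?_, ?_, h1⟩
    · rw [div_pow, div_le_iff₀ (by positivity), ← mul_pow]
      exact sq_le_sq.2 Real.abs_sin_le_abs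
    · rw [h1]
      exact Real.sin_sq_le_one _

end sinDivSq

/-- The entire function of `z` interpolating `1 / (z - is)`: it equals
`(1 - P z / P (is)) / (z - is)` with `P z = (sin (πΔz) / z)²`. -/
def poleInterp (Δ : ℝ) (z : ℂ) (s : ℝ) : ℂ :=
  -divDiff (sinDivSq Δ) (s * Complex.I) z / ((sinhDiv Δ s ^ 2 : ℝ) : ℂ)

/-- The extremal majorant of `oddF`. -/
def extremalMajorant (Δ : ℝ) (z : ℂ) : ℂ :=
  sinDivSq Δ z / (2 * Real.pi * Δ ^ 2) +
    ((∫ s in (0 : ℝ)..1, (poleInterp Δ z s + poleInterp Δ z (-s))) -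
      (poleInterp Δ z 1 + poleInterp Δ z (-1))) / 2

/-! ### The extremal majorant -/

section extremalMajorant

variable {Δ : ℝ}

theorem sinhDiv_sq_ne_zero (hΔ : 0 < Δ) (s : ℝ) : ((sinhDiv Δ s ^ 2 : ℝ) : ℂ) ≠ 0 := by
  have := sinhDiv_pos hΔ s
  exact_mod_cast (by positivity : sinhDiv Δ s ^ 2 ≠ 0)

theorem sub_mul_poleInterp (hΔ : 0 < Δ) (z : ℂ) (s : ℝ) :
    (z - s * Complex.I) * poleInterp Δ z s = 1 - sinDivSq Δ z / ((sinhDiv Δ s ^ 2 : ℝ) : ℂ) := by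
  have h := sub_mul_divDiff (differentiable_sinDivSq Δ) (s * Complex.I) z
  have h0 := sinhDiv_sq_ne_zero hΔ s
  rw [poleInterp, mul_div_assoc', mul_neg, h, sinDivSq_mul_I, neg_sub, sub_div, div_self h0]

/-- The derivative of `poleInterp` in its complex variable. -/
def poleInterpDeriv (Δ : ℝ) (z : ℂ) (s : ℝ) : ℂ :=
  -(∫ t in (0 : ℝ)..1,
    deriv (deriv (sinDivSq Δ)) (s * Complex.I + t * (z - s * Complex.I)) * t) /
      ((sinhDiv Δ s ^ 2 : ℝ) : ℂ)

theorem hasDerivAt_poleInterp (Δ : ℝ) (z : ℂ) (s : ℝ) :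
    HasDerivAt (fun w => poleInterp Δ w s) (poleInterpDeriv Δ z s) z :=
  (hasDerivAt_divDiff (differentiable_sinDivSq Δ) _ z).neg.div_const _

theorem continuous_ofReal_sinhDiv_sq (Δ : ℝ) :
    Continuous fun p : ℂ × ℝ => ((sinhDiv Δ p.2 ^ 2 : ℝ) : ℂ) :=
  Complex.continuous_ofReal.comp (((continuous_sinhDiv Δ).comp continuous_snd).pow 2)

theorem continuous_poleInterp (hΔ : 0 < Δ) :
    Continuous fun p : ℂ × ℝ => poleInterp Δ p.1 p.2 := by
  have h := (continuous_divDiff (differentiable_sinDivSq Δ)).comp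
    (f := fun p : ℂ × ℝ => ((p.2 : ℂ) * Complex.I, p.1)) (by fun_prop)
  exact h.neg.div (continuous_ofReal_sinhDiv_sq Δ) fun p => sinhDiv_sq_ne_zero hΔ p.2

theorem continuous_poleInterpDeriv (hΔ : 0 < Δ) :
    Continuous fun p : ℂ × ℝ => poleInterpDeriv Δ p.1 p.2 := by
  have h := (continuous_integral_deriv_deriv (differentiable_sinDivSq Δ)).comp
    (f := fun p : ℂ × ℝ => ((p.2 : ℂ) * Complex.I, p.1)) (by fun_prop)
  exact h.neg.div (continuous_ofReal_sinhDiv_sq Δ) fun p => sinhDiv_sq_ne_zero hΔ p.2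

theorem differentiable_integral_poleInterp (hΔ : 0 < Δ) :
    Differentiable ℂ fun z =>
      ∫ s in (0 : ℝ)..1, (poleInterp Δ z s + poleInterp Δ z (-s)) := by
  have hneg : Continuous fun p : ℂ × ℝ => -p.2 := continuous_snd.neg
  have hR := continuous_poleInterp hΔ
  have hD := continuous_poleInterpDeriv hΔ
  have hR' : Continuous fun p : ℂ × ℝ => poleInterp Δ p.1 (-p.2) :=
    hR.comp₂ continuous_fst hneg
  have hD' : Continuous fun p : ℂ × ℝ => poleInterpDeriv Δ p.1 (-p.2) :=
    hD.comp₂ continuous_fst hneg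
  have hd : ∀ (z : ℂ) (s : ℝ), HasDerivAt (fun w => poleInterp Δ w s + poleInterp Δ w (-s))
      (poleInterpDeriv Δ z s + poleInterpDeriv Δ z (-s)) z := fun z s =>
    HasDerivAt.fun_add (hasDerivAt_poleInterp Δ z s) (hasDerivAt_poleInterp Δ z (-s))
  refine fun z => (hasDerivAt_intervalIntegral_of_continuous
    (F := fun z s => poleInterp Δ z s + poleInterp Δ z (-s))
    (F' := fun z s => poleInterpDeriv Δ z s + poleInterpDeriv Δ z (-s)) ?_ ?_ hd
    z).differentiableAt
  · simp only [Function.uncurry_def]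
    exact hR.fun_add hR'
  · simp only [Function.uncurry_def]
    exact hD.fun_add hD'

theorem differentiable_extremalMajorant (hΔ : 0 < Δ) :
    Differentiable ℂ (extremalMajorant Δ) := by
  have hP := differentiable_sinDivSq Δ
  have hI := differentiable_integral_poleInterp hΔ
  have h1 : Differentiable ℂ fun z => poleInterp Δ z 1 := fun z =>
    (hasDerivAt_poleInterp Δ z 1).differentiableAt
  have h2 : Differentiable ℂ fun z => poleInterp Δ z (-1) := fun z =>
    (hasDerivAt_poleInterp Δ z (-1)).differentiableAt
  intro z
  unfold extremalMajorant
  exact ((hP z).div_const _).fun_add (((hI z).fun_sub ((h1 z).fun_add (h2 z))).div_const 2)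

/-- The conditions `|z| ≥ 2` and `|s| ≤ 1` keep `z` at distance at least `1` from the pole `is`, so
dividing by `z - is` does no harm. -/
theorem norm_poleInterp_le (hΔ : 0 < Δ) {z : ℂ} (hz : 2 ≤ ‖z‖) {s : ℝ} (hs : |s| ≤ 1) :
    ‖poleInterp Δ z s‖ ≤ (1 + 1 / (Real.pi * Δ) ^ 2) * Real.exp (2 * Real.pi * Δ * ‖z‖) := by
  have hpi := Real.pi_pos
  have h := congrArg norm (sub_mul_poleInterp hΔ z s)
  rw [norm_mul] at h
  have h1 : 1 ≤ ‖z - s * Complex.I‖ := by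
    have := norm_sub_norm_le z (s * Complex.I)
    rw [norm_mul, Complex.norm_I, mul_one, Complex.norm_real, Real.norm_eq_abs] at this
    linarith
  have hP := norm_sinDivSq_le hΔ (z := z) (by linarith)
  have he : 1 ≤ Real.exp (2 * Real.pi * Δ * ‖z‖) := Real.one_le_exp (by positivity)
  have hS := le_sinhDiv hΔ s
  calc ‖poleInterp Δ z s‖ ≤ ‖z - s * Complex.I‖ * ‖poleInterp Δ z s‖ :=
        le_mul_of_one_le_left (norm_nonneg _) h1
    _ = _ := h
    _ ≤ ‖(1 : ℂ)‖ + ‖sinDivSq Δ z / ((sinhDiv Δ s ^ 2 : ℝ) : ℂ)‖ := norm_sub_le _ _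
    _ ≤ 1 + Real.exp (2 * Real.pi * Δ * ‖z‖) / (Real.pi * Δ) ^ 2 := by
        rw [norm_one, norm_div, Complex.norm_real, Real.norm_of_nonneg (by positivity)]
        gcongr
    _ ≤ _ := by
        rw [add_mul, div_mul_eq_mul_div, one_mul]
        gcongr

theorem hasExpTypeAtMost_extremalMajorant (hΔ : 0 < Δ) :
    HasExpTypeAtMost (2 * Real.pi * Δ) (extremalMajorant Δ) := by
  have hpi := Real.pi_pos
  obtain ⟨M, hM⟩ := (isCompact_closedBall (0 : ℂ) 2).exists_bound_of_continuousOn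
    (differentiable_extremalMajorant hΔ).continuous.continuousOn
  set B := 1 + 1 / (Real.pi * Δ) ^ 2 with hB
  have hM0 : 0 ≤ M := (norm_nonneg _).trans (hM 0 (by simp))
  refine HasExpTypeAtMost.of_bound (A := M + (1 / (2 * Real.pi * Δ ^ 2) + 2 * B)) fun z => ?_
  have he : 1 ≤ Real.exp (2 * Real.pi * Δ * ‖z‖) := Real.one_le_exp (by positivity)
  rcases le_total ‖z‖ 2 with hz | hz
  · have h1 := hM z (by simpa using hz)
    have h2 : 0 ≤ 1 / (2 * Real.pi * Δ ^ 2) + 2 * B := by positivity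
    nlinarith
  · set E := Real.exp (2 * Real.pi * Δ * ‖z‖) with hE
    have hR : ∀ s : ℝ, |s| ≤ 1 → ‖poleInterp Δ z s‖ ≤ B * E := fun s hs =>
      norm_poleInterp_le hΔ hz hs
    have hI : ‖∫ s in (0 : ℝ)..1, (poleInterp Δ z s + poleInterp Δ z (-s))‖ ≤
        (B * E + B * E) * |1 - 0| := by
      refine intervalIntegral.norm_integral_le_of_norm_le_const fun s hs => ?_
      rw [uIoc_of_le zero_le_one] at hs
      have hs1 : |s| ≤ 1 := abs_le.2 ⟨by linarith [hs.1], hs.2⟩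
      exact (norm_add_le _ _).trans (add_le_add (hR s hs1) (hR (-s) (by rwa [abs_neg])))
    have h1 := hR 1 (by simp)
    have h2 := hR (-1) (by simp)
    have hP : ‖sinDivSq Δ z / (2 * Real.pi * Δ ^ 2)‖ ≤ 1 / (2 * Real.pi * Δ ^ 2) * E := by
      have h3 : ‖(2 * Real.pi * Δ ^ 2 : ℂ)‖ = 2 * Real.pi * Δ ^ 2 := by
        simp [abs_of_pos hpi]
      rw [norm_div, h3, div_mul_eq_mul_div, one_mul]
      gcongr
      exact norm_sinDivSq_le hΔ (by linarith)
    have h4 : ‖((∫ s in (0 : ℝ)..1, (poleInterp Δ z s + poleInterp Δ z (-s))) -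
      (poleInterp Δ z 1 + poleInterp Δ z (-1))) / 2‖ ≤ 2 * (B * E) := by
      rw [norm_div, Complex.norm_ofNat, div_le_iff₀ two_pos]
      refine (norm_sub_le _ _).trans ?_
      have := norm_add_le (poleInterp Δ z 1) (poleInterp Δ z (-1))
      simp only [sub_zero, abs_one, mul_one] at hI
      linarith
    have h5 := norm_add_le (sinDivSq Δ z / (2 * Real.pi * Δ ^ 2))
      (((∫ s in (0 : ℝ)..1, (poleInterp Δ z s + poleInterp Δ z (-s))) -
      (poleInterp Δ z 1 + poleInterp Δ z (-1))) / 2)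
    rw [extremalMajorant]
    have : 0 ≤ M * E := by positivity
    linarith

/-- The poles `±is` share the factor `1 - P x / P (is)`, as `P` is even on the imaginary axis, and
`1 / (x - is) + 1 / (x + is) = 2x / (x² + s²)`. -/
theorem poleInterp_add_poleInterp_neg (hΔ : 0 < Δ) {x s p : ℝ} (hp : sinDivSq Δ x = p)
    (h : x ≠ 0 ∨ s ≠ 0) : poleInterp Δ x s + poleInterp Δ x (-s) =
      ((2 * ((1 - p * (1 / sinhDiv Δ s ^ 2)) * (x / (x ^ 2 + s ^ 2))) : ℝ) : ℂ) := by
  have hpos : 0 < x ^ 2 + s ^ 2 := by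
    rcases h with h | h <;> positivity
  have hne : ((x ^ 2 + s ^ 2 : ℝ) : ℂ) ≠ 0 := by exact_mod_cast hpos.ne'
  have h1 := sub_mul_poleInterp hΔ x s
  have h2 := sub_mul_poleInterp hΔ x (-s)
  rw [sinhDiv_neg, hp] at h2
  rw [hp] at h1
  set r : ℂ := 1 - (p : ℂ) / ((sinhDiv Δ s ^ 2 : ℝ) : ℂ) with hr
  have h3 : ((2 * ((1 - p * (1 / sinhDiv Δ s ^ 2)) * (x / (x ^ 2 + s ^ 2))) : ℝ) : ℂ) =
      2 * r * x / ((x ^ 2 + s ^ 2 : ℝ) : ℂ) := by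
    rw [hr]; push_cast; ring
  rw [h3, eq_div_iff hne]
  have h4 : ((x ^ 2 + s ^ 2 : ℝ) : ℂ) = (x - s * Complex.I) * (x + s * Complex.I) := by
    push_cast
    linear_combination ((s : ℂ) ^ 2) * Complex.I_sq
  push_cast at h2
  rw [h4]
  linear_combination (x + s * Complex.I) * h1 + (x - s * Complex.I) * h2

theorem intervalIntegrable_mul_div_sq_add_sq {w : ℝ → ℝ} (hw : Continuous w) (x : ℝ) :
    IntervalIntegrable (fun s => w s * (x / (x ^ 2 + s ^ 2))) volume 0 1 := by
  rcases eq_or_ne x 0 with rfl | hx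
  · simp
  · refine Continuous.intervalIntegrable (hw.mul (continuous_const.div (by fun_prop) fun s => ?_))
      _ _
    exact (sq_add_sq_pos_of_ne_zero hx s).ne'

/-- The weighted integral that measures how far the extremal majorant is from `oddF`. -/
def gapIntegral (Δ x : ℝ) : ℝ :=
  (∫ s in (0 : ℝ)..1, 1 / sinhDiv Δ s ^ 2 * (x / (x ^ 2 + s ^ 2))) -
    1 / sinhDiv Δ 1 ^ 2 * (x / (x ^ 2 + 1 ^ 2))

theorem continuous_one_div_sinhDiv_sq (hΔ : 0 < Δ) :
    Continuous fun s => 1 / sinhDiv Δ s ^ 2 :=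
  continuous_const.div ((continuous_sinhDiv Δ).pow 2) fun s => by
    have := sinhDiv_pos hΔ s
    positivity

theorem extremalMajorant_ofReal (hΔ : 0 < Δ) {x p : ℝ} (hp : sinDivSq Δ x = p) :
    extremalMajorant Δ x =
      ((oddF x + p * (1 / (2 * Real.pi * Δ ^ 2) - gapIntegral Δ x) : ℝ) : ℂ) := by
  have hq := continuous_one_div_sinhDiv_sq hΔ
  have h1 : ∫ s in (0 : ℝ)..1, (poleInterp Δ x s + poleInterp Δ x (-s)) =
      ((∫ s in (0 : ℝ)..1, 2 * ((1 - p * (1 / sinhDiv Δ s ^ 2)) * (x / (x ^ 2 + s ^ 2))) : ℝ) :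
        ℂ) := by
    rw [← intervalIntegral.integral_ofReal]
    -- Only `s` in `(0, 1]` matters, which avoids the excluded case `x = s = 0`.
    refine intervalIntegral.integral_congr_ae (Eventually.of_forall fun s hs => ?_)
    rw [uIoc_of_le zero_le_one] at hs
    exact poleInterp_add_poleInterp_neg hΔ hp (.inr hs.1.ne')
  have h2 := poleInterp_add_poleInterp_neg hΔ hp (x := x) (s := 1) (.inr one_ne_zero)
  have h3 : ∫ s in (0 : ℝ)..1, 2 * ((1 - p * (1 / sinhDiv Δ s ^ 2)) * (x / (x ^ 2 + s ^ 2))) =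
      2 * (Real.arctan (1 / x) -
        p * ∫ s in (0 : ℝ)..1, 1 / sinhDiv Δ s ^ 2 * (x / (x ^ 2 + s ^ 2))) := by
    rw [intervalIntegral.integral_const_mul, ← integral_zero_one_div_sq_add_sq,
      ← intervalIntegral.integral_const_mul p, ← intervalIntegral.integral_sub]
    · congr 1
      refine intervalIntegral.integral_congr fun s _ => ?_
      ring
    · simpa using intervalIntegrable_mul_div_sq_add_sq (continuous_const (y := 1)) x
    · exact (intervalIntegrable_mul_div_sq_add_sq hq x).const_mul p
  rw [extremalMajorant, h1, h2, h3, hp, oddF, gapIntegral]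
  push_cast
  ring

theorem gapIntegral_neg (Δ x : ℝ) : gapIntegral Δ (-x) = -gapIntegral Δ x := by
  simp only [gapIntegral, neg_sq, neg_div, mul_neg, intervalIntegral.integral_neg]
  ring

/-- For `x ≥ 0` the integrand decreases in `s`, so its integral over `[0, 1]` is at least its value
at `s = 1` and the gap is nonnegative. From above, `sinhDiv Δ s ≥ πΔ` bounds the integral by `arctan
(1/x) / (πΔ)²`, and `arctan < π / 2`. -/
theorem abs_gapIntegral_le (hΔ : 0 < Δ) (x : ℝ) :
    |gapIntegral Δ x| ≤ 1 / (2 * Real.pi * Δ ^ 2) := by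
  have hpi := Real.pi_pos
  have hq := continuous_one_div_sinhDiv_sq hΔ
  have key : ∀ x : ℝ, 0 ≤ x → |gapIntegral Δ x| ≤ 1 / (2 * Real.pi * Δ ^ 2) := fun x hx => by
    have hS1 := sinhDiv_pos hΔ 1
    have h1 : 1 / sinhDiv Δ 1 ^ 2 * (x / (x ^ 2 + 1 ^ 2)) ≤
        ∫ s in (0 : ℝ)..1, 1 / sinhDiv Δ s ^ 2 * (x / (x ^ 2 + s ^ 2)) := by
      rcases hx.eq_or_lt with rfl | hx0
      · simp
      have : ∫ _ in (0 : ℝ)..1, 1 / sinhDiv Δ 1 ^ 2 * (x / (x ^ 2 + 1 ^ 2)) ≤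
          ∫ s in (0 : ℝ)..1, 1 / sinhDiv Δ s ^ 2 * (x / (x ^ 2 + s ^ 2)) := by
        refine intervalIntegral.integral_mono_on zero_le_one intervalIntegrable_const
          (intervalIntegrable_mul_div_sq_add_sq hq x) fun s hs => ?_
        have hS := sinhDiv_pos hΔ s
        have hs0 := hs.1
        have := sinhDiv_le_sinhDiv hΔ hs.1 hs.2
        have := hs.2
        gcongr
      simpa using this
    have h2 : ∫ s in (0 : ℝ)..1, 1 / sinhDiv Δ s ^ 2 * (x / (x ^ 2 + s ^ 2)) ≤
        1 / (2 * Real.pi * Δ ^ 2) := by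
      have h3 : ∫ s in (0 : ℝ)..1, 1 / sinhDiv Δ s ^ 2 * (x / (x ^ 2 + s ^ 2)) ≤
          ∫ s in (0 : ℝ)..1, 1 / (Real.pi * Δ) ^ 2 * (x / (x ^ 2 + s ^ 2)) := by
        refine intervalIntegral.integral_mono_on zero_le_one
          (intervalIntegrable_mul_div_sq_add_sq hq x)
          (intervalIntegrable_mul_div_sq_add_sq continuous_const x) fun s _ => ?_
        have := le_sinhDiv hΔ s
        gcongr
      rw [intervalIntegral.integral_const_mul, integral_zero_one_div_sq_add_sq] at h3
      refine h3.trans ?_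
      calc _ ≤ 1 / (Real.pi * Δ) ^ 2 * (Real.pi / 2) := by
            gcongr
            exact (Real.arctan_lt_pi_div_two _).le
        _ = _ := by field_simp
    have h4 : 0 ≤ 1 / sinhDiv Δ 1 ^ 2 * (x / (x ^ 2 + 1 ^ 2)) := by positivity
    rw [gapIntegral, abs_le]
    constructor <;> linarith
  rcases le_total 0 x with hx | hx
  · exact key x hx
  · rw [← abs_neg, ← gapIntegral_neg]
    exact key (-x) (by linarith)

theorem extremalMajorant_sub_oddF (hΔ : 1 ≤ Δ) (x : ℝ) :
    (extremalMajorant Δ x).im = 0 ∧ oddF x ≤ (extremalMajorant Δ x).re ∧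
      (extremalMajorant Δ x).re ≤ oddF x + 2 * Real.pi / (1 + x ^ 2) := by
  have hΔ0 : 0 < Δ := by linarith
  have hpi := Real.pi_gt_three
  obtain ⟨p, hp, hp0, hp1, hp2, -⟩ := exists_sinDivSq_ofReal hΔ0 x
  rw [extremalMajorant_ofReal hΔ0 hp]
  have hg := abs_le.1 (abs_gapIntegral_le hΔ0 x)
  set A := 1 / (2 * Real.pi * Δ ^ 2) with hA
  refine ⟨Complex.ofReal_im _, ?_, ?_⟩
  · rw [Complex.ofReal_re]
    have := mul_nonneg hp0 (sub_nonneg.2 hg.2)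
    linarith
  · rw [Complex.ofReal_re]
    have h1 : p * (A - gapIntegral Δ x) ≤ p * (1 / (Real.pi * Δ ^ 2)) := by
      gcongr
      have : 1 / (Real.pi * Δ ^ 2) = A + A := by rw [hA]; field_simp; ring
      linarith
    -- The factor `1 + x²` is split: `p ≤ (πΔ)²` handles `1` and contributes `π`; `p * x² ≤ 1`
    -- handles `x²` and contributes `1`, which is at most `π`.
    have h2 : p * (1 / (Real.pi * Δ ^ 2)) * (1 + x ^ 2) ≤ 2 * Real.pi := by
      have h3 : p * (1 / (Real.pi * Δ ^ 2)) ≤ Real.pi := by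
        calc _ ≤ (Real.pi * Δ) ^ 2 * (1 / (Real.pi * Δ ^ 2)) := by gcongr
          _ = Real.pi := by field_simp
      have h4 : 1 / (Real.pi * Δ ^ 2) ≤ 1 := by
        rw [div_le_one (by positivity)]
        nlinarith
      have h5 : p * (1 / (Real.pi * Δ ^ 2)) * x ^ 2 ≤ 1 := by
        calc _ = p * x ^ 2 * (1 / (Real.pi * Δ ^ 2)) := by ring
          _ ≤ 1 * 1 := by gcongr
          _ = 1 := one_mul 1
      linarith
    have h6 : p * (1 / (Real.pi * Δ ^ 2)) ≤ 2 * Real.pi / (1 + x ^ 2) := by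
      rwa [le_div_iff₀ (by positivity)]
    linarith

theorem norm_extremalMajorant_ofReal_le (hΔ : 1 ≤ Δ) (x : ℝ) :
    ‖extremalMajorant Δ x‖ ≤ 8 / (1 + x ^ 2) := by
  obtain ⟨h1, h2, h3⟩ := extremalMajorant_sub_oddF hΔ x
  have h4 := abs_le.1 (abs_oddF_le x)
  have hpi := Real.pi_lt_d2
  have hpi0 := Real.pi_pos
  have h5 : extremalMajorant Δ x = ((extremalMajorant Δ x).re : ℂ) :=
    Complex.ext (by simp) (by simpa using h1)
  rw [h5, Complex.norm_real, Real.norm_eq_abs, abs_le]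
  -- The constant `8` exceeds `π/2 + 2π`.
  have h6 : Real.pi / 2 / (1 + x ^ 2) + 2 * Real.pi / (1 + x ^ 2) ≤ 8 / (1 + x ^ 2) := by
    rw [← add_div]
    gcongr
    linarith
  have h7 : 0 ≤ 2 * Real.pi / (1 + x ^ 2) := by positivity
  constructor <;> linarith

theorem isMajorant_extremalMajorant (hΔ : 1 ≤ Δ) : IsMajorant Δ oddF (extremalMajorant Δ) where
  realEntire := ⟨differentiable_extremalMajorant (by linarith),
    fun x => (extremalMajorant_sub_oddF hΔ x).1⟩
  expType := hasExpTypeAtMost_extremalMajorant (by linarith)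
  le x := (extremalMajorant_sub_oddF hΔ x).2.1

theorem integrable_extremalMajorant (hΔ : 1 ≤ Δ) :
    Integrable (fun x : ℝ => extremalMajorant Δ x) :=
  (integrable_const_div_one_add_sq 8).mono'
    ((differentiable_extremalMajorant (by linarith)).continuous.comp
      Complex.continuous_ofReal).aestronglyMeasurable
    (Eventually.of_forall (norm_extremalMajorant_ofReal_le hΔ))

/-- Every term of the symmetrized quadrature vanishes: `P` is zero at the nodes `n / Δ` with `n ≠
0`, and the value at `0` is `π / 2`. -/
theorem integral_extremalMajorant (hΔ : 1 ≤ Δ) :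
    ∫ x : ℝ, (extremalMajorant Δ x).re = Real.pi / (2 * Δ) := by
  have hΔ0 : 0 < Δ := by linarith
  have hpi := Real.pi_pos
  have h1 := (isMajorant_extremalMajorant hΔ).hasSum_symm hΔ0 (integrable_extremalMajorant hΔ)
  have h2 : ∀ n : ℤ, n ≠ 0 → (extremalMajorant Δ ((n / Δ : ℝ) : ℂ)).re = oddF (n / Δ) := by
    intro n hn
    obtain ⟨p, hp, -, -, -, hp3⟩ := exists_sinDivSq_ofReal hΔ0 (n / Δ)
    have h3 : Real.sin (Real.pi * Δ * (n / Δ)) = 0 := by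
      rw [show Real.pi * Δ * (n / Δ) = n * Real.pi by field_simp]
      exact Real.sin_int_mul_pi n
    have hx : (n / Δ : ℝ) ^ 2 ≠ 0 := pow_ne_zero 2 (div_ne_zero (by exact_mod_cast hn) hΔ0.ne')
    have hp0 : p = 0 := by
      rw [h3, zero_pow two_ne_zero] at hp3
      exact (mul_eq_zero.1 hp3).resolve_right hx
    rw [extremalMajorant_ofReal hΔ0 hp, Complex.ofReal_re, hp0, zero_mul, add_zero]
  -- At `0` both `oddF` and `gapIntegral` are `0`, which leaves `(πΔ)² / (2πΔ²)`.
  have h0 : (extremalMajorant Δ ((0 : ℝ) : ℂ)).re = Real.pi / 2 := by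
    rw [extremalMajorant_ofReal hΔ0 (p := (Real.pi * Δ) ^ 2)
      (by rw [Complex.ofReal_zero, sinDivSq_zero]), Complex.ofReal_re]
    simp only [oddF, gapIntegral, zero_div, mul_zero, intervalIntegral.integral_zero, div_zero,
      Real.arctan_zero, sub_zero]
    field_simp
    ring
  have h3 : (fun n : ℤ => (extremalMajorant Δ ((n / Δ : ℝ) : ℂ)).re +
      (extremalMajorant Δ ((-(n / Δ) : ℝ) : ℂ)).re - if n = 0 then Real.pi else 0) =
      fun _ => 0 := by
    funext n
    split_ifs with hn
    · subst hn
      simp only [Int.cast_zero, zero_div, neg_zero, h0]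
      ring
    · have h4 := h2 (-n) (by simpa using hn)
      rw [Int.cast_neg, neg_div, oddF_neg] at h4
      rw [h2 n hn, h4]
      ring
  rw [h3] at h1
  have h4 := h1.unique hasSum_zero
  rw [eq_div_iff (by positivity)]
  linarith

/-- On the real line `|M| ≤ 8` and `|x M| ≤ 4`. Phragmén–Lindelöf for `M` and for `z M` gives `(1 +
Δ|z|) |M| ≤ (8 + 4Δ) exp (2πΔ|y|)`, and `8 + 4Δ ≤ 12Δ²` for `Δ ≥ 1`. -/
theorem hasGrowthBound_extremalMajorant (hΔ : 1 ≤ Δ) :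
    HasGrowthBound 12 Δ (extremalMajorant Δ) := by
  intro z
  have hΔ0 : 0 < Δ := by linarith
  have hd := differentiable_extremalMajorant hΔ0
  have hE := hasExpTypeAtMost_extremalMajorant hΔ0
  have hb := norm_extremalMajorant_ofReal_le hΔ
  have h1 := hE.norm_le_of_bounded hd (M := 8) (fun x => (hb x).trans
    (div_le_self (by norm_num) (by nlinarith [sq_nonneg x]))) z
  have hE' := hasExpTypeAtMost_id.mul hE
  rw [zero_add] at hE'
  have h2 := HasExpTypeAtMost.norm_le_of_bounded (F := fun z => z * extremalMajorant Δ z)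
    (differentiable_id.mul hd) hE' (M := 4) (fun x => by
    rw [norm_mul, Complex.norm_real, Real.norm_eq_abs]
    calc _ ≤ |x| * (8 / (1 + x ^ 2)) := by gcongr; exact hb x
      _ ≤ 4 := by
        rw [mul_div_assoc', div_le_iff₀ (by positivity)]
        nlinarith [sq_nonneg (|x| - 1), sq_abs x]) z
  rw [norm_mul] at h2
  set E := Real.exp (2 * Real.pi * Δ * |z.im|) with hEd
  have hEpos : 0 < E := Real.exp_pos _
  have hz : 0 < 1 + Δ * ‖z‖ := by positivity
  rw [← mul_assoc, mul_div_assoc', div_mul_eq_mul_div, le_div_iff₀ hz]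
  have h3 : Δ * (‖z‖ * ‖extremalMajorant Δ z‖) ≤ Δ * (4 * E) := by gcongr
  have h4 : (8 + 4 * Δ) * E ≤ 12 * Δ ^ 2 * E := by
    gcongr
    nlinarith
  linarith

end extremalMajorant

end

/-! ### Assembly of the bounds and the main theorem -/

theorem HasGrowthBound.hasExpTypeAtMost {C Δ : ℝ} {K : ℂ → ℂ} (hΔ : 0 < Δ)
    (h : HasGrowthBound C Δ K) : HasExpTypeAtMost (2 * Real.pi * Δ) K := by
  refine HasExpTypeAtMost.of_bound (A := |C| * Δ ^ 2) fun z => (h z).trans ?_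
  have hpi := Real.pi_pos
  rw [mul_assoc |C|]
  have h1 : Δ ^ 2 / (1 + Δ * ‖z‖) ≤ Δ ^ 2 :=
    div_le_self (by positivity) (le_add_of_nonneg_right (by positivity))
  have h2 := Complex.abs_im_le_norm z
  exact mul_le_mul (le_abs_self C) (by gcongr) (by positivity) (abs_nonneg C)

theorem HasGrowthBound.mono {C C' Δ : ℝ} {K : ℂ → ℂ} (hΔ : 0 < Δ) (hC : C ≤ C')
    (h : HasGrowthBound C Δ K) : HasGrowthBound C' Δ K := fun z =>
  (h z).trans (mul_le_mul_of_nonneg_right hC (by positivity))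

theorem HasGrowthBound.oddReflect {C Δ : ℝ} {K : ℂ → ℂ} (h : HasGrowthBound C Δ K) :
    HasGrowthBound C Δ (oddReflect K) := fun z => by
  simpa [_root_.oddReflect] using h (-z)

theorem hasBandlimitedFourier_of_le {Δ : ℝ} {K : ℂ → ℂ} (hΔ : 0 < Δ) (hK : Differentiable ℂ K)
    (hE : HasExpTypeAtMost (2 * Real.pi * Δ) K) (hb : ∀ x : ℝ, ‖K x‖ ≤ 8 / (1 + x ^ 2)) :
    HasBandlimitedFourier 26 Δ K := by
  have hi : Integrable (fun x : ℝ => K x) :=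
    (integrable_const_div_one_add_sq 8).mono'
      (hK.continuous.comp Complex.continuous_ofReal).aestronglyMeasurable
      (Eventually.of_forall hb)
  refine ⟨hi, continuous_fourier_of_integrable hi, fun ξ hξ => ?_, fun ξ _ => ?_⟩
  · rw [mem_Icc, ← abs_le, not_le] at hξ
    exact hE.fourier_eq_zero hΔ hK hi hξ.le
  · have h1 := hE.norm_fourier_le hΔ.le hK hi ξ 0
    simp only [abs_zero, mul_zero, add_zero, Real.exp_zero, mul_one] at h1
    -- The constant `26` comes from `∫ 8 / (1 + x²) = 8π < 26`; it also exceeds the constants `8`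
    -- and `12` of the other bounds.
    refine h1.trans ((integral_mono hi.norm (integrable_const_div_one_add_sq 8) hb).trans ?_)
    simp_rw [div_eq_mul_inv]
    rw [integral_const_mul, integral_univ_inv_one_add_sq]
    linarith [Real.pi_lt_d2]

theorem norm_oddReflect_le {K : ℂ → ℂ} (hb : ∀ x : ℝ, ‖K x‖ ≤ 8 / (1 + x ^ 2)) (x : ℝ) :
    ‖oddReflect K x‖ ≤ 8 / (1 + x ^ 2) := by
  rw [oddReflect_ofReal, norm_neg]
  simpa using hb (-x)

theorem integral_re_oddReflect (K : ℂ → ℂ) :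
    ∫ x : ℝ, (oddReflect K x).re = -∫ x : ℝ, (K x).re := by
  simp_rw [oddReflect_ofReal, Complex.neg_re]
  rw [integral_neg]
  exact congrArg _ (integral_neg_eq_self (fun x : ℝ => (K x).re) volume)

theorem extremalProperties_extremalMajorant {Δ : ℝ} (hΔ : 1 ≤ Δ) :
    ExtremalProperties 26 Δ (oddReflect (extremalMajorant Δ)) (extremalMajorant Δ) := by
  have hΔ0 : 0 < Δ := by linarith
  have hM := isMajorant_extremalMajorant hΔ
  have hm := hM.oddReflect
  have hb := norm_extremalMajorant_ofReal_le hΔ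
  have hb' := norm_oddReflect_le hb
  have hi := integrable_extremalMajorant hΔ
  have hi' := integrable_oddReflect hi
  have hire : Integrable (fun x : ℝ => (extremalMajorant Δ x).re) := hi.re
  have hire' : Integrable (fun x : ℝ => (oddReflect (extremalMajorant Δ) x).re) := hi'.re
  have hint := integral_extremalMajorant hΔ
  have hgrowth := (hasGrowthBound_extremalMajorant hΔ).mono hΔ0 (C' := 26) (by norm_num)
  refine ⟨hm.realEntire, hM.realEntire, fun x => ⟨?_, hm.le x, hM.le x, ?_⟩, hgrowth.oddReflect,
    hgrowth, hasBandlimitedFourier_of_le hΔ0 hm.realEntire.entire hm.expType hb',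
    hasBandlimitedFourier_of_le hΔ0 hM.realEntire.entire hM.expType hb,
    hire.sub integrable_oddF, ?_, integrable_oddF.sub hire', ?_⟩
  · have h1 := neg_le_of_abs_le ((Complex.abs_re_le_norm _).trans (hb' x))
    have h2 : (8 : ℝ) / (1 + x ^ 2) ≤ 26 / (1 + x ^ 2) := by gcongr; norm_num
    rw [neg_div]
    linarith
  · have h1 := le_of_abs_le ((Complex.abs_re_le_norm _).trans (hb x))
    have h2 : (8 : ℝ) / (1 + x ^ 2) ≤ 26 / (1 + x ^ 2) := by gcongr; norm_num
    linarith
  · rw [integral_sub hire integrable_oddF, integral_oddF, sub_zero, hint]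
  · rw [integral_sub integrable_oddF hire', integral_oddF, integral_re_oddReflect, hint]
    ring

/-- The growth bound supplies the exponential type for any constant, and `∫ oddF = 0` turns the
prescribed distances into the minimal integral, so uniqueness applies to `kp` and to the reflection
of `km`. -/
theorem ExtremalProperties.eq_extremalMajorant {C Δ : ℝ} (hΔ : 1 ≤ Δ) {km kp : ℂ → ℂ}
    (h : ExtremalProperties C Δ km kp) :
    km = oddReflect (extremalMajorant Δ) ∧ kp = extremalMajorant Δ := by
  have hΔ0 : 0 < Δ := by linarith
  have hM := isMajorant_extremalMajorant hΔ
  have hi := integrable_extremalMajorant hΔ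
  have hint := integral_extremalMajorant hΔ
  have hkp : IsMajorant Δ oddF kp :=
    ⟨h.realEntire_p, h.growth_p.hasExpTypeAtMost hΔ0, fun x => (h.ineq x).2.2.1⟩
  have hkm : IsMinorant Δ oddF km :=
    ⟨h.realEntire_m, h.growth_m.hasExpTypeAtMost hΔ0, fun x => (h.ineq x).2.1⟩
  have hip := h.fourier_p.integrable
  have him := h.fourier_m.integrable
  have hipre : Integrable (fun x : ℝ => (kp x).re) := hip.re
  have himre : Integrable (fun x : ℝ => (km x).re) := him.re
  have hp := h.integral_p
  rw [integral_sub hipre integrable_oddF, integral_oddF, sub_zero] at hp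
  have hm := h.integral_m
  rw [integral_sub integrable_oddF himre, integral_oddF, zero_sub,
    ← integral_re_oddReflect] at hm
  refine ⟨?_, hkp.unique hΔ0 hip hp hM hi hint⟩
  rw [← hkm.oddReflect.unique hΔ0 (integrable_oddReflect him) hm hM hi hint,
    oddReflect_oddReflect]

theorem lemma5 :
    ∃ C : ℝ, 0 < C ∧ ∀ Δ : ℝ, 1 ≤ Δ →
      ∃ mm mp : ℂ → ℂ,
        ExtremalProperties C Δ mm mp ∧
        IsExtremalMinorant Δ oddF mm ∧ IsExtremalMajorant Δ oddF mp ∧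
        (∀ (C' : ℝ) (km kp : ℂ → ℂ), ExtremalProperties C' Δ km kp → km = mm ∧ kp = mp) ∧
        (∀ km : ℂ → ℂ, IsExtremalMinorant Δ oddF km → km = mm) ∧
        (∀ kp : ℂ → ℂ, IsExtremalMajorant Δ oddF kp → kp = mp) := by
  refine ⟨26, by norm_num, fun Δ hΔ =>
    ⟨oddReflect (extremalMajorant Δ), extremalMajorant Δ, ?_⟩⟩
  obtain ⟨hext, huniq⟩ := (isMajorant_extremalMajorant hΔ).isExtremalMajorant (by linarith)
    (integrable_extremalMajorant hΔ) (integral_extremalMajorant hΔ)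
  refine ⟨extremalProperties_extremalMajorant hΔ, hext.oddReflect, hext,
    fun C' km kp h => h.eq_extremalMajorant hΔ, fun km hkm => ?_, huniq⟩
  rw [← huniq _ hkm.oddReflect, oddReflect_oddReflect]
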